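/- **Setting.** Let $T\ge 1$ tasks share a true predictor $f^*:\mathbb R^{d_x}\to\mathbb R^{d_y}$. First-task inputs $x_{11},\dots,x_{1m}$ are i.i.d. with law $\mathcal D_1$; for $t>1$, $x_{ti}=g_t(x_{1i},\dots,x_{t-1,i})$ with deterministic measurable maps $g_t$; labels are $y_{ti}=f^*(x_{ti})+v_{ti}$. A law on $\mathbb R^d$ is called sub-Gaussian with proxy variance $s$ if it has mean zero and $\mathbb E\,e^{u\langle z,w\rangle}\le e^{su^2/2}$ for all $u\in\mathbb R$ and all unit vectors $w$. The law $\mathcal D_1$ is sub-Gaussian with independent coordinates and proxy variance $\sigma^2/d_x$, $\sigma>0$. The $m$ trajectories (inputs together with noise) are independent; conditionally on the inputs of a trajectory, its noise vectors $v_{1i},\dots,v_{Ti}$ are independent and each is sub-Gaussian with independent coordinates and proxy variance $\nu^2$, $\nu\ge0$. For each task $t$ a fixed set $\mathcal R_t\subset[m]$ of samples is stored; $n_t=|\mathcal R_t|$, and $\mathcal R_T=[m]$ for the current task. The class is $\mathcal F=\{f_\theta:\theta\in\Theta\}$ with $\Theta\subset\mathbb R^p$ bounded of diameter $\Delta$,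 $f^*\in\mathcal F$, and $f_\theta(x_t)\in L^q$ for all $\theta\in\Theta$, $t\in[T]$, where $q\in[1,\infty)$ is fixed. Put $\|h\|_{\mathcal F}=\frac1T\sum_{t\in[T]}(\mathbb E\|h(x_t)\|_q^q)^{1/q}$. Let $G_{f,t}$ be the map sending the first input $x_1$ to $f(x_t)-f^*(x_t)$. **Assumptions.** (i) $\mathbb E\|G_{f,t}(x_1)\|_2^4<\infty$ and $\mathbb E\|G_{f,t}(x_1)\|_2^2>0$ for all $f\in\mathcal F\setminus\{f^*\}$, $t\in[T]$. (ii) For constants $L_{\mathcal F},L_G>0$: $\|f_\theta-f_{\theta'}\|_{\mathcal F}\le L_{\mathcal F}\|\theta-\theta'\|_2$ on $\Theta$, and each $G_{f,t}$, $f\in\mathcal F$, is $L_G$-Lipschitz on $\mathbb R^{d_x}$. (iii) For all $f,f'\in\mathcal F$, $t\in[T]$ and all $z$ with $\|z\|_2\le r_x$, both $\|G_{f,t}(z)-G_{f',t}(z)\|_2$ and $\big|\|G_{f,t}(z)\|_2^2-\|G_{f',t}(z)\|_2^2\big|$ are at most $K_G\|f-f'\|_{\mathcal F}$, where $K_G=k_G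 r_x^{\alpha}$ with $k_G,\alpha>0$ and $$r_x=\sigma\Big(3+16\sqrt{\Lambda/d_x}\Big),\qquad \Lambda=\ln\Big(\tfrac{4Tm}{\delta}\,(1+L_G\sigma L_{\mathcal F}\Delta)\,\big(1+\tfrac{L_G^2\sigma^2}{k_G\sigma^\alpha}\big)\Big).$$ **Method.** Let $\beta_t=4^{-(T-t)}$. For $\tau=1,\dots,T$ in turn, $\hat\theta_\tau$ is a global minimizer over $\theta\in\Theta$ of $$\beta_\tau\sum_{i\in[m]}\|f_\theta(x_{\tau i})-y_{\tau i}\|_2^2+\sum_{t<\tau}\sum_{i\in\mathcal R_t}\beta_t\|f_\theta(x_{ti})-f_{\tilde\theta}(x_{ti})\|_2^2,$$ where either $\tilde\theta=\hat\theta_{\tau-1}$ throughout, or $\tilde\theta=\hat\theta_t$ throughout. **Theorem.** Let $\delta\in(0,1)$, $$\kappa=\sup_{f\in\mathcal F\setminus\{f^*\}}\sup_{t\in[T]}\frac{(\mathbb E\|G_{f,t}(x_1)\|_2^4)^{1/2}}{\mathbb E\|G_{f,t}(x_1)\|_2^2}\in[0,\infty],$$ $r_v=2\nu\big(\sqrt{d_y}+8\sqrt{2\ln(4Tm/\delta)}\big)$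 and $\ell=\ln\big(1+L_{\mathcal F}\Delta\,Tm\,(1+r_v)\big)$. There is a universal constant $c>0$ such that in the setting above, for each of the two choices of $\tilde\theta$, if $$n_t\ \ge\ c\,\kappa^2\big(p\,\ell+\ln(4/\delta)\big)\qquad\text{for all }t\in[T],$$ then with probability at least $1-\delta$ $$\sum_{t\in[T]}\frac{\beta_t n_t}{\sum_{s\in[T]}\beta_s n_s}\,\mathbb E\big\|f^*(x_t)-f_{\hat\theta_T}(x_t)\big\|_2^2\ \le\ c\,\frac{\nu^2\big(pT\,\ell+\ln(4/\delta)\big)+k_G\,r_x^{\alpha}}{\sum_{t\in[T]}\beta_t n_t},$$ where the expectation is over a fresh input $x_1\sim\mathcal D_1$, with $x_t$ its task-$t$ input, independent of $\hat\theta_T$. Up to logarithmic factors the right-hand side is $\big(\nu^2(pT+\ln(1/\delta))+\mathrm{poly}(\sigma)\big)/\sum_t\beta_tn_t$. -/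

import Mathlib

open MeasureTheory ProbabilityTheory
open scoped NNReal ENNReal

noncomputable section

namespace ContinualLearning

/-- `ℝ^d` with the Euclidean norm. -/
abbrev Vec (d : ℕ) : Type := EuclideanSpace ℝ (Fin d)

/-! ### Tasks

Tasks are numbered `0, 1, …, T - 1`, so that task `t` here is task `t + 1` in one-based counting. -/

/-- The input of task `t` as a function of the input `z` of the first task: the first input is `z`
itself, and the input of every later task `t` is `g t` applied to the `t` earlier inputs.
(The value `g 0` is never used.) -/
def taskInput {dx : ℕ} (g : (t : ℕ) → (Fin t → Vec dx) → Vec dx) : ℕ → Vec dx → Vec dx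
  | 0, z => z
  | t + 1, z => g (t + 1) (fun s : Fin (t + 1) => taskInput g s.1 z)
termination_by t => t
decreasing_by exact s.2

/-- The direct difference map of the predictors with parameters `θ` and `θs`: it sends the input of
the first task to the difference of the two predictions on the input of task `t`. -/
def directDiff {p dx dy : ℕ} (g : (t : ℕ) → (Fin t → Vec dx) → Vec dx)
    (f : Vec p → Vec dx → Vec dy) (θs θ : Vec p) (t : ℕ) (z : Vec dx) : Vec dy :=
  f θ (taskInput g t z) - f θs (taskInput g t z)

/-- The task-averaged `q`-norm `(1/T) ∑ₜ (E ‖h(xₜ)‖_q^q)^(1/q)` of a function `h`, where the first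
input has law `D`. -/
def taskNorm {dx dy : ℕ} (D : Measure (Vec dx)) (g : (t : ℕ) → (Fin t → Vec dx) → Vec dx)
    (T : ℕ) (q : ℝ) (h : Vec dx → Vec dy) : ℝ :=
  (1 / (T : ℝ)) * ∑ t : Fin T, (∫ z, ∑ j, |h (taskInput g t z) j| ^ q ∂D) ^ (1 / q)

/-! ### Data model -/

/-- `μ` is the law of a sub-Gaussian random vector with independent coordinates and proxy
variance `s`: it has mean zero, `E exp(u ⟨z, w⟩) ≤ exp(s u² / 2)` for all real `u` and all unit
vectors `w`, and the coordinates are independent. -/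
structure IsSubGaussianVec {d : ℕ} (μ : Measure (Vec d)) (s : ℝ≥0) : Prop where
  integrable : Integrable (fun z : Vec d => z) μ
  mean_zero : ∫ z, z ∂μ = 0
  mgf_le : ∀ w : Vec d, ‖w‖ = 1 → HasSubgaussianMGF (fun z : Vec d => inner ℝ z w) s μ
  indep_coord : iIndepFun (fun (j : Fin d) (z : Vec d) => z j) μ

/-- The random data: `x i` is the first-task input of the `i`-th trajectory and `v t i` is the noise
of its label in task `t`.
* The trajectories are independent and the first-task inputs have law `D`, a sub-Gaussian law on
  `ℝ^dx` with independent coordinates and proxy variance `σ² / dx`.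
* Conditionally on the inputs of the trajectory, the noise vectors of the different tasks are
  independent, each of them sub-Gaussian with independent coordinates and proxy variance `ν²`.
  (All inputs of a trajectory are functions of the first one, so conditioning on them is
  conditioning on the first one.) -/
structure DataModel {T m dx dy : ℕ} {Ω : Type*} [MeasurableSpace Ω] (P : Measure Ω)
    [IsProbabilityMeasure P] (D : Measure (Vec dx)) (σ ν : ℝ≥0)
    (x : Fin m → Ω → Vec dx) (v : Fin T → Fin m → Ω → Vec dy) : Prop where
  measurable_input : ∀ i, Measurable (x i)
  measurable_noise : ∀ t i, Measurable (v t i)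
  law_input : ∀ i, P.map (x i) = D
  indep_trajectories : iIndepFun (fun i ω => (x i ω, fun t : Fin T => v t i ω)) P
  subGaussian_input : IsSubGaussianVec D (σ ^ 2 / (dx : ℝ≥0))
  indep_noise : ∀ i, ∀ᵐ z ∂D, iIndepFun (fun (t : Fin T) (u : Fin T → Vec dy) => u t)
    (condDistrib (fun ω (t : Fin T) => v t i ω) (x i) P z)
  subGaussian_noise : ∀ i, ∀ᵐ z ∂D, ∀ t : Fin T, IsSubGaussianVec
    ((condDistrib (fun ω (t : Fin T) => v t i ω) (x i) P z).map (fun u => u t)) (ν ^ 2)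

/-! ### Assumptions on the predictors -/

/-- Every direct difference map has a finite fourth moment and, unless the predictor is the true
one, a positive second moment. -/
def MomentAssumption {p dx dy : ℕ} (D : Measure (Vec dx))
    (g : (t : ℕ) → (Fin t → Vec dx) → Vec dx) (T : ℕ) (f : Vec p → Vec dx → Vec dy)
    (Θ : Set (Vec p)) (θs : Vec p) : Prop :=
  ∀ θ ∈ Θ, f θ ≠ f θs → ∀ t : Fin T,
    Integrable (fun z => ‖directDiff g f θs θ t z‖ ^ 4) D ∧
      0 < ∫ z, ‖directDiff g f θs θ t z‖ ^ 2 ∂D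

/-- The constant `κ`: the supremum, over predictors other than the true one and over tasks, of
`(E ‖G‖⁴)^(1/2) / E ‖G‖²` for the direct difference map `G`; it may be infinite. -/
def momentRatio {p dx dy : ℕ} (D : Measure (Vec dx))
    (g : (t : ℕ) → (Fin t → Vec dx) → Vec dx) (T : ℕ) (f : Vec p → Vec dx → Vec dy)
    (Θ : Set (Vec p)) (θs : Vec p) : ℝ≥0∞ :=
  ⨆ (θ : Vec p) (_ : θ ∈ Θ) (_ : f θ ≠ f θs) (t : Fin T),
    ENNReal.ofReal (√(∫ z, ‖directDiff g f θs θ t z‖ ^ 4 ∂D) /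
      ∫ z, ‖directDiff g f θs θ t z‖ ^ 2 ∂D)

/-- The Lipschitz-type conditions, with constants `LF`, `LG`, and with constant `KG` on the closed
ball of radius `r`. -/
structure LipschitzAssumption {p dx dy : ℕ} (D : Measure (Vec dx))
    (g : (t : ℕ) → (Fin t → Vec dx) → Vec dx) (T : ℕ) (q : ℝ) (f : Vec p → Vec dx → Vec dy)
    (Θ : Set (Vec p)) (θs : Vec p) (LF LG r KG : ℝ) : Prop where
  param : ∀ θ ∈ Θ, ∀ θ' ∈ Θ, taskNorm D g T q (fun a => f θ a - f θ' a) ≤ LF * ‖θ - θ'‖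
  input : ∀ θ ∈ Θ, ∀ t : Fin T, ∀ z z' : Vec dx,
    ‖directDiff g f θs θ t z - directDiff g f θs θ t z'‖ ≤ LG * ‖z - z'‖
  ball : ∀ θ ∈ Θ, ∀ θ' ∈ Θ, ∀ t : Fin T, ∀ z : Vec dx, ‖z‖ ≤ r →
    ‖directDiff g f θs θ t z - directDiff g f θs θ' t z‖
      ≤ KG * taskNorm D g T q (fun a => f θ a - f θ' a)
  ball_sq : ∀ θ ∈ Θ, ∀ θ' ∈ Θ, ∀ t : Fin T, ∀ z : Vec dx, ‖z‖ ≤ r →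
    |‖directDiff g f θs θ t z‖ ^ 2 - ‖directDiff g f θs θ' t z‖ ^ 2|
      ≤ KG * taskNorm D g T q (fun a => f θ a - f θ' a)

/-! ### The distillation method -/

/-- The two knowledge-distillation regularizers: on the stored inputs of an earlier task, match
either the most recently learned predictor, or the predictor learned right after that task. -/
inductive Distillation where
  | latest
  | taskwise

/-- The parameter whose predictor is to be matched on the stored inputs of the earlier task `s`
while task `τ` is being learned. -/
def Distillation.target {p T : ℕ} (reg : Distillation) (θhat : Fin T → Vec p) (τ s : Fin T) :
    Vec p :=
  match reg with
  | .latest => θhat ⟨τ.1 - 1, lt_of_le_of_lt (Nat.sub_le _ _) τ.2⟩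
  | .taskwise => θhat s

/-- The objective that is minimized when task `τ` is learned: the weighted squared loss on all `m`
samples of task `τ` plus the distillation regularizer on the stored samples of the earlier tasks.
There is no regularization in the first task. Here `x i` is the first-task input of the `i`-th
trajectory, `y t i` its label in task `t`, `R s` the set of stored samples of task `s`, and `β` the
weights. -/
def distillObjective {T m p dx dy : ℕ} (reg : Distillation)
    (g : (t : ℕ) → (Fin t → Vec dx) → Vec dx) (f : Vec p → Vec dx → Vec dy)
    (R : Fin T → Finset (Fin m)) (β : Fin T → ℝ) (x : Fin m → Vec dx)
    (y : Fin T → Fin m → Vec dy) (θhat : Fin T → Vec p) (τ : Fin T) (θ : Vec p) : ℝ :=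
  β τ * ∑ i : Fin m, ‖f θ (taskInput g τ (x i)) - y τ i‖ ^ 2 +
    ∑ s ∈ Finset.univ.filter (fun s : Fin T => s < τ), ∑ i ∈ R s,
      β s * ‖f θ (taskInput g s (x i)) - f (reg.target θhat τ s) (taskInput g s (x i))‖ ^ 2

/-- `θhat` is a sequence of parameters learned one task after the other: each is a global minimizer
over `Θ` of the objective of its task. -/
def IsDistillSequence {T m p dx dy : ℕ} (reg : Distillation)
    (g : (t : ℕ) → (Fin t → Vec dx) → Vec dx) (f : Vec p → Vec dx → Vec dy) (Θ : Set (Vec p))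
    (R : Fin T → Finset (Fin m)) (β : Fin T → ℝ) (x : Fin m → Vec dx)
    (y : Fin T → Fin m → Vec dy) (θhat : Fin T → Vec p) : Prop :=
  ∀ τ : Fin T, θhat τ ∈ Θ ∧ IsMinOn (distillObjective reg g f R β x y θhat τ) Θ (θhat τ)

/-- The exponentially decaying weights `4^{-(T - t)}` (one-based `t`). -/
def distillWeight (T : ℕ) (t : Fin T) : ℝ := (1 / 4 : ℝ) ^ (T - 1 - t.1)

/-- The last task. -/
def lastTask (T : ℕ) [NeZero T] : Fin T := ⟨T - 1, Nat.sub_one_lt (NeZero.ne T)⟩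

/-- `∑ₜ βₜ nₜ`, where `nₜ` is the number of stored samples of task `t`. -/
def totalWeight {T m : ℕ} (R : Fin T → Finset (Fin m)) : ℝ :=
  ∑ t : Fin T, distillWeight T t * ((R t).card : ℝ)

/-- The weighted error `∑ₜ (βₜ nₜ / ∑ₛ βₛ nₛ) E ‖f*(xₜ) - f_θ(xₜ)‖²`, where the expectation is over a
fresh first-task input with law `D`. -/
def weightedError {T m p dx dy : ℕ} (D : Measure (Vec dx))
    (g : (t : ℕ) → (Fin t → Vec dx) → Vec dx) (f : Vec p → Vec dx → Vec dy) (θs : Vec p)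
    (R : Fin T → Finset (Fin m)) (θ : Vec p) : ℝ :=
  ∑ t : Fin T, distillWeight T t * ((R t).card : ℝ) / totalWeight R *
    ∫ z, ‖f θs (taskInput g t z) - f θ (taskInput g t z)‖ ^ 2 ∂D

/-! ### Logarithmic quantities -/

/-- The radius `σ (3 + 16 √(Λ / dx))` with the logarithmic quantity
`Λ = ln ((4 T m / δ) (1 + LG σ LF Δ) (1 + LG² σ² / (kG σ^α)))`. -/
def inputRadius (T m dx : ℕ) (δ σ LF LG kG α Δ : ℝ) : ℝ :=
  σ * (3 + 16 * √(Real.log (4 * T * m / δ * (1 + LG * σ * LF * Δ) *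
    (1 + LG ^ 2 * σ ^ 2 / (kG * σ ^ α))) / dx))

/-- The radius `2 ν (√dy + 8 √(2 ln (4 T m / δ)))`. -/
def noiseRadius (T m dy : ℕ) (δ ν : ℝ) : ℝ :=
  2 * ν * (√dy + 8 * √(2 * Real.log (4 * T * m / δ)))

/-- The logarithmic quantity `ln (1 + LF Δ T m (1 + r_v))`, with `r_v` the noise radius. -/
def netLog (T m dy : ℕ) (δ ν LF Δ : ℝ) : ℝ :=
  Real.log (1 + LF * Δ * T * m * (1 + noiseRadius T m dy δ ν))

end ContinualLearning

end

/-! Write `G` for the direct difference map and `M_t = ∑ᵢ (⟨v_ti, G⟩ - ‖G‖²/4)`, taken at the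
predictor learned in task `t`. The proof separates a deterministic recursion from concentration over
a finite net.

Deterministic part (`IsDistillSequence.weighted_sq_le`). Comparing each minimizer with `θs` bounds
its errors by its noise correlation and by the errors of the predictors it is distilled from. Each
round of distillation costs at most a factor 4, exactly the growth of the weights, so the costs do
not compound: the final weighted empirical error is at most `4 ∑ₜ M_t`.

Noise part (`DataModel.measure_noise_sum_gt_le`). The negative quadratic term in `M_t` absorbs the
sub-Gaussian moment generating function, so for fixed predictors `∑ₜ M_t` exceeds `2ν²L` with
probability at most `exp(-L)`, whatever the size of `G`. This is the source of the fast rate. Every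
task has its own learned predictor, so the union bound runs over `T`-tuples of net points and costs
`T log |N|`.

From empirical to population error (`measure_sum_lt_half_le`). A nonnegative variable whose second
moment is at most `κ²` times its squared mean has an empirical mean at least half the true mean, up
to probability `exp(-n/(8κ²))`. No upper tail is needed.

Passing to the net uses the Lipschitz conditions, which hold only on the ball of radius `r`. The
samples lie there with high probability; for population errors, `integral_le_two_mul_setIntegral`
shows that the ball carries at least half of the integral. The net radius is chosen so that the
total discretization error is a multiple of `kG r^α`. -/

namespace ContinualLearning

/-! ### Concentration of sub-Gaussian vectors -/

lemma lintegral_exp_mul_gaussianReal (v : ℝ≥0) (x : ℝ) :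
    ∫⁻ t, ENNReal.ofReal (Real.exp (x * t)) ∂(gaussianReal 0 v)
      = ENNReal.ofReal (Real.exp (v * x ^ 2 / 2)) := by
  rw [← ofReal_integral_eq_lintegral_ofReal (integrable_exp_mul_gaussianReal x)
    (Filter.Eventually.of_forall fun _ => (Real.exp_pos _).le)]
  have := congrFun (mgf_id_gaussianReal (μ := 0) (v := v)) x
  simp only [mgf, id] at this
  rw [this]
  simp

lemma lintegral_exp_sq_gaussianReal {c : ℝ≥0} (hc : 0 < c) :
    ∫⁻ t, ENNReal.ofReal (Real.exp (c * t ^ 2 / 2)) ∂(gaussianReal 0 (1 / (2 * c)))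
      = ENNReal.ofReal (√2) := by
  have hc' : (0 : ℝ) < c := hc
  have hv : (1 / (2 * c) : ℝ≥0) ≠ 0 := by positivity
  rw [gaussianReal_of_var_ne_zero _ hv,
    lintegral_withDensity_eq_lintegral_mul _ (measurable_gaussianPDF _ _) (by fun_prop)]
  have h1 : ∀ t : ℝ, (gaussianPDF 0 (1 / (2 * c)) *
      fun t => ENNReal.ofReal (Real.exp (c * t ^ 2 / 2))) t
      = ENNReal.ofReal ((√(2 * Real.pi * (1 / (2 * c))))⁻¹ * Real.exp (-(c / 2) * t ^ 2)) := by
    intro t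
    rw [Pi.mul_apply, gaussianPDF, ← ENNReal.ofReal_mul (gaussianPDFReal_nonneg _ _ _),
      gaussianPDFReal_def]
    congr 1
    simp only [NNReal.coe_div, NNReal.coe_one, NNReal.coe_mul, NNReal.coe_ofNat]
    rw [mul_assoc, ← Real.exp_add]
    congr 2
    field_simp
    ring
  simp_rw [h1]
  have hi : Integrable (fun t : ℝ => Real.exp (-(c / 2 : ℝ) * t ^ 2)) :=
    integrable_exp_neg_mul_sq (by positivity)
  rw [← ofReal_integral_eq_lintegral_ofReal (hi.const_mul _)
    (Filter.Eventually.of_forall fun _ => by positivity), integral_const_mul, integral_gaussian,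
    ← Real.sqrt_inv, ← Real.sqrt_mul (by positivity)]
  congr 2
  field_simp

/-- Gaussian decoupling: `exp(X²/(4c))` is the average of `exp(Xt)` over an independent `t ~ N(0,
1/(2c))`. After exchanging the integrals, the sub-Gaussian bound leaves a Gaussian integral equal to
`√2`. -/
lemma lintegral_exp_sq_le_of_hasSubgaussianMGF {Ω : Type*} [MeasurableSpace Ω] {μ : Measure Ω}
    [SFinite μ] {X : Ω → ℝ} {c : ℝ≥0} (hc : 0 < c) (h : HasSubgaussianMGF X c μ) :
    ∫⁻ ω, ENNReal.ofReal (Real.exp (X ω ^ 2 / (4 * c))) ∂μ ≤ ENNReal.ofReal (√2) := by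
  have hc' : (0 : ℝ) < c := hc
  have hX : AEMeasurable X μ := h.aemeasurable
  calc ∫⁻ ω, ENNReal.ofReal (Real.exp (X ω ^ 2 / (4 * c))) ∂μ
      = ∫⁻ ω, ∫⁻ t, ENNReal.ofReal (Real.exp (X ω * t)) ∂(gaussianReal 0 (1 / (2 * c))) ∂μ := by
        refine lintegral_congr fun ω => ?_
        rw [lintegral_exp_mul_gaussianReal]
        congr 2
        simp only [NNReal.coe_div, NNReal.coe_one, NNReal.coe_mul, NNReal.coe_ofNat]
        field_simp
        ring
    _ = ∫⁻ t, ∫⁻ ω, ENNReal.ofReal (Real.exp (X ω * t)) ∂μ ∂(gaussianReal 0 (1 / (2 * c))) := by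
        refine lintegral_lintegral_swap ?_
        refine ENNReal.measurable_ofReal.comp_aemeasurable
          (Real.measurable_exp.comp_aemeasurable ?_)
        exact (hX.comp_fst).mul measurable_snd.aemeasurable
    _ ≤ ∫⁻ t, ENNReal.ofReal (Real.exp (c * t ^ 2 / 2)) ∂(gaussianReal 0 (1 / (2 * c))) := by
        refine lintegral_mono fun t => ?_
        have h1 := h.integrable_exp_mul t
        have h2 := h.mgf_le t
        simp_rw [mul_comm (X _) t]
        rw [← ofReal_integral_eq_lintegral_ofReal h1
          (Filter.Eventually.of_forall fun _ => (Real.exp_pos _).le)]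
        exact ENNReal.ofReal_le_ofReal h2
    _ = _ := lintegral_exp_sq_gaussianReal hc

lemma IsSubGaussianVec.hasSubgaussianMGF_coord {d : ℕ} {μ : Measure (Vec d)} {s : ℝ≥0}
    (h : IsSubGaussianVec μ s) (j : Fin d) : HasSubgaussianMGF (fun z : Vec d => z j) s μ := by
  have := h.mgf_le (EuclideanSpace.single j 1) (by simp)
  simpa [EuclideanSpace.inner_single_right] using this

lemma IsSubGaussianVec.lintegral_exp_norm_sq_le {d : ℕ} {μ : Measure (Vec d)} {s : ℝ≥0}
    (h : IsSubGaussianVec μ s) (hs : 0 < s) :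
    ∫⁻ z, ENNReal.ofReal (Real.exp (‖z‖ ^ 2 / (4 * s))) ∂μ ≤ ENNReal.ofReal (√2 ^ d) := by
  have := h.indep_coord.isProbabilityMeasure
  have h1 : ∀ z : Vec d, ENNReal.ofReal (Real.exp (‖z‖ ^ 2 / (4 * s)))
      = ∏ j, ENNReal.ofReal (Real.exp (z j ^ 2 / (4 * s))) := by
    intro z
    rw [← ENNReal.ofReal_prod_of_nonneg (fun _ _ => (Real.exp_pos _).le), ← Real.exp_sum,
      EuclideanSpace.real_norm_sq_eq, Finset.sum_div]
  simp_rw [h1]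
  rw [lintegral_prod_eq_prod_lintegral_of_indepFun Finset.univ
    (fun j (z : Vec d) => ENNReal.ofReal (Real.exp (z j ^ 2 / (4 * s))))
    (h.indep_coord.comp (fun _ y => ENNReal.ofReal (Real.exp (y ^ 2 / (4 * s))))
      (fun _ => by fun_prop)) (fun _ => by fun_prop)]
  refine (Finset.prod_le_prod' fun j _ =>
    lintegral_exp_sq_le_of_hasSubgaussianMGF hs (h.hasSubgaussianMGF_coord j)).trans ?_
  rw [Finset.prod_const, Finset.card_univ, Fintype.card_fin,
    ENNReal.ofReal_pow (Real.sqrt_nonneg _)]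

/-- Markov's inequality for `exp(‖z‖²/(4s))`. Its mean is at most `√2 ^ d ≤ exp(d/2)`, which
accounts for the term `2sd`. -/
lemma IsSubGaussianVec.measure_norm_gt_le {d : ℕ} {μ : Measure (Vec d)} {s : ℝ≥0}
    (h : IsSubGaussianVec μ s) (hs : 0 < s) {r L : ℝ} (hr : 0 ≤ r)
    (hL : 2 * s * d + 4 * s * L ≤ r ^ 2) :
    μ {z | r < ‖z‖} ≤ ENNReal.ofReal (Real.exp (-L)) := by
  have hs' : (0 : ℝ) < s := hs
  have hmono : μ {z | r < ‖z‖} ≤ μ {z | ENNReal.ofReal (Real.exp (r ^ 2 / (4 * s)))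
      ≤ ENNReal.ofReal (Real.exp (‖z‖ ^ 2 / (4 * s)))} := by
    refine measure_mono fun z hz => ?_
    simp only [Set.mem_ofPred_eq] at hz ⊢
    gcongr
  refine hmono.trans ((meas_ge_le_lintegral_div (by fun_prop) (by simp [Real.exp_pos])
    ENNReal.ofReal_ne_top).trans ?_)
  refine (ENNReal.div_le_div_right (h.lintegral_exp_norm_sq_le hs) _).trans ?_
  rw [← ENNReal.ofReal_div_of_pos (Real.exp_pos _)]
  refine ENNReal.ofReal_le_ofReal ?_
  rw [div_le_iff₀ (Real.exp_pos _), ← Real.exp_add]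
  have h2 : √2 ≤ Real.exp (1 / 2) := by
    rw [Real.sqrt_le_left (Real.exp_pos _).le, ← Real.exp_nat_mul]
    have := Real.add_one_le_exp (1 : ℝ)
    norm_num at this ⊢
    linarith
  calc √2 ^ d ≤ Real.exp (1 / 2) ^ d := by gcongr
    _ = Real.exp (d * (1 / 2)) := by rw [← Real.exp_nat_mul]
    _ ≤ _ := by
      refine Real.exp_le_exp.2 ?_
      have : (2 * s * d + 4 * s * L) / (4 * s) ≤ r ^ 2 / (4 * s) := by gcongr
      have h3 : (2 * s * d + 4 * s * L) / (4 * s) = d * (1 / 2) + L := by field_simp; ring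
      linarith

lemma IsSubGaussianVec.ae_eq_zero {d : ℕ} {μ : Measure (Vec d)}
    (h : IsSubGaussianVec μ 0) : ∀ᵐ z ∂μ, z = 0 := by
  have h1 : ∀ j : Fin d, ∀ᵐ z ∂μ, (z : Vec d) j = 0 := fun j => by
    have := h.indep_coord.isProbabilityMeasure
    exact (h.hasSubgaussianMGF_coord j).ae_eq_zero_of_hasSubgaussianMGF_zero
  filter_upwards [ae_all_iff.2 h1] with z hz
  ext j
  simpa using hz j

lemma IsSubGaussianVec.lintegral_exp_inner_le {d : ℕ} {μ : Measure (Vec d)} {s : ℝ≥0}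
    (h : IsSubGaussianVec μ s) (a : Vec d) :
    ∫⁻ z, ENNReal.ofReal (Real.exp (inner ℝ z a)) ∂μ
      ≤ ENNReal.ofReal (Real.exp (s * ‖a‖ ^ 2 / 2)) := by
  have := h.indep_coord.isProbabilityMeasure
  rcases eq_or_ne a 0 with rfl | ha
  · simp
  have hn : ‖a‖ ≠ 0 := norm_ne_zero_iff.2 ha
  have hw : ‖(‖a‖⁻¹ : ℝ) • a‖ = 1 := by simp [norm_smul, hn]
  have h1 := (h.mgf_le _ hw).integrable_exp_mul ‖a‖
  have h2 := (h.mgf_le _ hw).mgf_le ‖a‖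
  have h3 : ∀ z : Vec d, ‖a‖ * inner ℝ z ((‖a‖⁻¹ : ℝ) • a) = inner ℝ z a := by
    intro z
    rw [inner_smul_right, ← mul_assoc, mul_inv_cancel₀ hn, one_mul]
  simp only [mgf, h3] at h1 h2
  rw [← ofReal_integral_eq_lintegral_ofReal h1
    (Filter.Eventually.of_forall fun _ => (Real.exp_pos _).le)]
  exact ENNReal.ofReal_le_ofReal h2

/-! ### Lower tail of sums of nonnegative random variables -/

lemma exp_neg_le_quadratic {y : ℝ} (hy : 0 ≤ y) : Real.exp (-y) ≤ 1 - y + y ^ 2 / 2 := by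
  rw [Real.exp_neg, inv_le_iff_one_le_mul₀ (Real.exp_pos _)]
  have h1 := Real.quadratic_le_exp_of_nonneg hy
  have h2 : 0 ≤ 1 - y + y ^ 2 / 2 := by nlinarith [sq_nonneg (y - 1)]
  have h3 : (1 - y + y ^ 2 / 2) * (1 + y + y ^ 2 / 2) = 1 + y ^ 4 / 4 := by ring
  nlinarith [mul_le_mul_of_nonneg_left h1 h2, sq_nonneg (y ^ 2)]

/-- Chernoff's method for the lower tail: since `h ≥ 0`, the bound `exp(-y) ≤ 1 - y + y²/2` makes
two moments of `h` sufficient. -/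
lemma measure_sum_lt_half_le {Ω E ι : Type*} [MeasurableSpace Ω] [MeasurableSpace E]
    {P : Measure Ω} [IsProbabilityMeasure P] {D : Measure E} {x : ι → Ω → E}
    (hx : ∀ i, Measurable (x i)) (hlaw : ∀ i, P.map (x i) = D) (hind : iIndepFun x P)
    {h : E → ℝ} (hm : Measurable h) (h0 : ∀ z, 0 ≤ h z)
    (hint : Integrable h D) (hint2 : Integrable (fun z => h z ^ 2) D) {K : ℝ}
    (hpos : 0 < ∫ z, h z ∂D) (hK : ∫ z, h z ^ 2 ∂D ≤ K * (∫ z, h z ∂D) ^ 2) (hK0 : 0 < K)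
    (S : Finset ι) :
    P {ω | ∑ i ∈ S, h (x i ω) < S.card * (∫ z, h z ∂D) / 2}
      ≤ ENNReal.ofReal (Real.exp (-(S.card / (8 * K)))) := by
  set a := ∫ z, h z ∂D with ha
  -- This `l` minimizes the exponent `-la + l²Ka²/2 + la/2` per sample. Each factor contributes
  -- `-3/(8K)` and the threshold returns `2/(8K)`.
  set l : ℝ := 1 / (2 * K * a) with hl
  have hl0 : 0 < l := by positivity
  rcases S.eq_empty_or_nonempty with rfl | ⟨i0, -⟩
  · simp
  have hD : IsProbabilityMeasure D := by
    rw [← hlaw i0]; exact Measure.isProbabilityMeasure_map (hx i0).aemeasurable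
  have hone : ∀ i, ∫⁻ ω, ENNReal.ofReal (Real.exp (-(l * h (x i ω)))) ∂P
      ≤ ENNReal.ofReal (Real.exp (-(3 / (8 * K)))) := by
    intro i
    have h1 : ∫⁻ ω, ENNReal.ofReal (Real.exp (-(l * h (x i ω)))) ∂P
        = ∫⁻ z, ENNReal.ofReal (Real.exp (-(l * h z))) ∂D := by
      rw [← hlaw i, lintegral_map (by fun_prop) (hx i)]
    have hI' : Integrable (fun z => 1 - l * h z) D :=
      (integrable_const _).sub (hint.const_mul l)
    have hI : Integrable (fun z => 1 - l * h z + l ^ 2 / 2 * h z ^ 2) D :=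
      hI'.add (hint2.const_mul _)
    have hle : ∀ z, Real.exp (-(l * h z)) ≤ 1 - l * h z + l ^ 2 / 2 * h z ^ 2 := fun z =>
      (exp_neg_le_quadratic (mul_nonneg hl0.le (h0 z))).trans (le_of_eq (by ring))
    rw [h1]
    calc ∫⁻ z, ENNReal.ofReal (Real.exp (-(l * h z))) ∂D
        ≤ ∫⁻ z, ENNReal.ofReal (1 - l * h z + l ^ 2 / 2 * h z ^ 2) ∂D :=
          lintegral_mono fun z => ENNReal.ofReal_le_ofReal (hle z)
      _ = ENNReal.ofReal (∫ z, (1 - l * h z + l ^ 2 / 2 * h z ^ 2) ∂D) :=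
          (ofReal_integral_eq_lintegral_ofReal hI (Filter.Eventually.of_forall fun z =>
            (Real.exp_pos _).le.trans (hle z))).symm
      _ ≤ _ := by
          refine ENNReal.ofReal_le_ofReal ?_
          rw [integral_add hI' (hint2.const_mul _),
            integral_sub (integrable_const _) (hint.const_mul l), integral_const_mul,
            integral_const_mul, ← ha]
          simp only [integral_const, probReal_univ, smul_eq_mul, mul_one]
          have h3 : l * a = 1 / (2 * K) := by rw [hl]; field_simp
          have h4 : l ^ 2 / 2 * (K * a ^ 2) = 1 / (8 * K) := by rw [hl]; field_simp; ring
          have h5 : l ^ 2 / 2 * ∫ z, h z ^ 2 ∂D ≤ l ^ 2 / 2 * (K * a ^ 2) := by gcongr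
          have h6 := Real.add_one_le_exp (-(3 / (8 * K)))
          have h7 : 1 / (2 * K) = 4 / (8 * K) := by field_simp; norm_num
          have h8 : (4 : ℝ) / (8 * K) = 3 / (8 * K) + 1 / (8 * K) := by ring
          linarith
  have hprod : ∫⁻ ω, ∏ i ∈ S, ENNReal.ofReal (Real.exp (-(l * h (x i ω)))) ∂P
      ≤ ENNReal.ofReal (Real.exp (-(S.card * (3 / (8 * K))))) := by
    rw [lintegral_prod_eq_prod_lintegral_of_indepFun S
      (fun i ω => ENNReal.ofReal (Real.exp (-(l * h (x i ω)))))
      (hind.comp (fun _ z => ENNReal.ofReal (Real.exp (-(l * h z)))) (fun _ => by fun_prop))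
      (fun i => by have := hx i; fun_prop)]
    refine (Finset.prod_le_prod' fun i _ => hone i).trans (le_of_eq ?_)
    rw [Finset.prod_const, ← ENNReal.ofReal_pow (Real.exp_pos _).le, ← Real.exp_nat_mul]
    congr 2
    ring
  have hmono : P {ω | ∑ i ∈ S, h (x i ω) < S.card * a / 2}
      ≤ P {ω | ENNReal.ofReal (Real.exp (-(S.card * (2 / (8 * K)))))
        ≤ ∏ i ∈ S, ENNReal.ofReal (Real.exp (-(l * h (x i ω))))} := by
    refine measure_mono fun ω hω => ?_
    simp only [Set.mem_ofPred_eq] at hω ⊢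
    rw [← ENNReal.ofReal_prod_of_nonneg (fun _ _ => (Real.exp_pos _).le), ← Real.exp_sum]
    refine ENNReal.ofReal_le_ofReal (Real.exp_le_exp.2 ?_)
    rw [Finset.sum_neg_distrib, ← Finset.mul_sum, neg_le_neg_iff]
    refine (mul_le_mul_of_nonneg_left hω.le hl0.le).trans (le_of_eq ?_)
    rw [hl]
    field_simp
    ring
  refine hmono.trans ((meas_ge_le_lintegral_div (Measurable.aemeasurable ?_)
    (by simp [Real.exp_pos]) ENNReal.ofReal_ne_top).trans ?_)
  · exact Finset.measurable_prod _ fun i _ => by have := hx i; fun_prop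
  refine (ENNReal.div_le_div_right hprod _).trans ?_
  rw [← ENNReal.ofReal_div_of_pos (Real.exp_pos _), ← Real.exp_sub]
  refine ENNReal.ofReal_le_ofReal (Real.exp_le_exp.2 (le_of_eq ?_))
  ring

/-! ### Finite nets -/

open Metric in
-- Volume comparison: the balls of radius `ε/2` around the points are disjoint and fit into the ball
-- of radius `Δ + ε/2` around `θs`.
lemma card_le_of_separated {p : ℕ} {ε Δ : ℝ} (hε : 0 < ε) (hΔ : 0 ≤ Δ) (θs : Vec p)
    (s : Finset (Vec p)) (hs : ∀ c ∈ s, dist c θs ≤ Δ)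
    (h : ∀ c ∈ s, ∀ d ∈ s, c ≠ d → ε ≤ dist c d) :
    (s.card : ℝ) ≤ (1 + 2 * Δ / ε) ^ p := by
  have hε2 : 0 < ε / 2 := by positivity
  have hρ : 0 < Δ + ε / 2 := by positivity
  set μ : Measure (Vec p) := volume
  have hdisj : Set.Pairwise (s : Set (Vec p))
      (Function.onFun Disjoint fun c => ball (c : Vec p) (ε / 2)) := by
    rintro c hc d hd hcd
    refine ball_disjoint_ball ?_
    rw [add_halves]
    exact h c hc d hd hcd
  have hsub : ⋃ c ∈ s, ball (c : Vec p) (ε / 2) ⊆ ball θs (Δ + ε / 2) := by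
    refine Set.iUnion₂_subset fun c hc => ball_subset_ball' ?_
    linarith [hs c hc]
  have hvol : (s.card : ℝ≥0∞) * ENNReal.ofReal ((ε / 2) ^ p) * μ (ball 0 1)
      ≤ ENNReal.ofReal ((Δ + ε / 2) ^ p) * μ (ball 0 1) := by
    calc (s.card : ℝ≥0∞) * ENNReal.ofReal ((ε / 2) ^ p) * μ (ball 0 1)
        = μ (⋃ c ∈ s, ball (c : Vec p) (ε / 2)) := by
          rw [measure_biUnion_finset hdisj fun c _ => measurableSet_ball]
          simp only [μ.addHaar_ball_of_pos _ hε2, finrank_euclideanSpace, Fintype.card_fin]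
          simp only [Finset.sum_const, nsmul_eq_mul, mul_assoc]
      _ ≤ μ (ball θs (Δ + ε / 2)) := measure_mono hsub
      _ = _ := by
          simp only [μ.addHaar_ball_of_pos _ hρ, finrank_euclideanSpace, Fintype.card_fin]
  have hJ : (s.card : ℝ≥0∞) * ENNReal.ofReal ((ε / 2) ^ p)
      ≤ ENNReal.ofReal ((Δ + ε / 2) ^ p) :=
    (ENNReal.mul_le_mul_iff_left (measure_ball_pos _ _ zero_lt_one).ne' measure_ball_lt_top.ne).1
      hvol
  have hK := ENNReal.toReal_le_of_le_ofReal (by positivity) hJ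
  rw [ENNReal.toReal_mul, ENNReal.toReal_natCast, ENNReal.toReal_ofReal (by positivity),
    ← le_div_iff₀ (by positivity), ← div_pow] at hK
  refine hK.trans (le_of_eq ?_)
  congr 1
  field_simp
  ring

/-- An `ε`-separated subset of largest cardinality is a net. It lies inside `Θ`, where the
assumptions on the predictors apply. -/
lemma exists_finite_net {p : ℕ} {ε : ℝ} (hε : 0 < ε) {Θ : Set (Vec p)}
    (hΘ : Bornology.IsBounded Θ) {θs : Vec p} (hθs : θs ∈ Θ) :
    ∃ N : Finset (Vec p), (N : Set (Vec p)) ⊆ Θ ∧ N.Nonempty ∧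
      (N.card : ℝ) ≤ (1 + 2 * Metric.diam Θ / ε) ^ p ∧ ∀ θ ∈ Θ, ∃ θ' ∈ N, ‖θ - θ'‖ ≤ ε := by
  classical
  let Q : ℕ → Prop := fun n => ∃ s : Finset (Vec p), (s : Set (Vec p)) ⊆ Θ ∧
    (∀ c ∈ s, ∀ d ∈ s, c ≠ d → ε ≤ dist c d) ∧ s.card = n
  have hbound : ∀ s : Finset (Vec p), (s : Set (Vec p)) ⊆ Θ →
      (∀ c ∈ s, ∀ d ∈ s, c ≠ d → ε ≤ dist c d) →
      (s.card : ℝ) ≤ (1 + 2 * Metric.diam Θ / ε) ^ p := fun s hs h =>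
    card_le_of_separated hε Metric.diam_nonneg θs s
      (fun c hc => Metric.dist_le_diam_of_mem hΘ (hs hc) hθs) h
  set B := ⌊(1 + 2 * Metric.diam Θ / ε) ^ p⌋₊
  have hQB : ∀ n, Q n → n ≤ B := by
    rintro n ⟨s, hs, h, rfl⟩
    exact Nat.le_floor (hbound s hs h)
  have hQ1 : Q 1 := ⟨{θs}, by simpa using hθs, by simp, by simp⟩
  have hmax : Q (Nat.findGreatest Q B) := Nat.findGreatest_spec (hQB 1 hQ1) hQ1
  have h1 : 1 ≤ Nat.findGreatest Q B := Nat.le_findGreatest (hQB 1 hQ1) hQ1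
  obtain ⟨s, hs, hsep, hcard⟩ := hmax
  refine ⟨s, hs, Finset.card_pos.1 (by omega), hbound s hs hsep, fun θ hθ => ?_⟩
  by_contra! hcon
  have hnot : θ ∉ s := fun hmem => by
    have := hcon θ hmem
    simp only [sub_self, norm_zero] at this
    linarith
  have hQ' : Q (s.card + 1) := by
    refine ⟨insert θ s, ?_, ?_, Finset.card_insert_of_notMem hnot⟩
    · rw [Finset.coe_insert]
      exact Set.insert_subset hθ hs
    · intro c hc d hd hcd
      rcases Finset.mem_insert.1 hc with rfl | hc' <;> rcases Finset.mem_insert.1 hd with rfl | hd'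
      · exact absurd rfl hcd
      · rw [dist_eq_norm]; exact (hcon d hd').le
      · rw [dist_comm, dist_eq_norm]; exact (hcon c hc').le
      · exact hsep c hc' d hd' hcd
  have := Nat.le_findGreatest (hQB _ hQ') hQ'
  omega

/-! ### Consequences of the data model -/

section DataModel

variable {T m dx dy : ℕ} {Ω : Type*} [MeasurableSpace Ω] {P : Measure Ω}
  [IsProbabilityMeasure P] {D : Measure (Vec dx)} {σ ν : ℝ≥0} {x : Fin m → Ω → Vec dx}
  {v : Fin T → Fin m → Ω → Vec dy}

lemma DataModel.lintegral_eq (hM : DataModel P D σ ν x v) (i : Fin m)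
    {F : Vec dx × (Fin T → Vec dy) → ℝ≥0∞} (hF : Measurable F) :
    ∫⁻ ω, F (x i ω, fun t => v t i ω) ∂P
      = ∫⁻ z, ∫⁻ u, F (z, u) ∂(condDistrib (fun ω (t : Fin T) => v t i ω) (x i) P z) ∂D := by
  have hv : Measurable fun ω (t : Fin T) => v t i ω :=
    measurable_pi_lambda _ fun t => hM.measurable_noise t i
  rw [← hM.law_input i, ← Measure.lintegral_compProd hF, compProd_map_condDistrib hv.aemeasurable,
    lintegral_map hF ((hM.measurable_input i).prodMk hv)]

lemma DataModel.measure_noise_mem_le (hM : DataModel P D σ ν x v) [IsProbabilityMeasure D]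
    (t : Fin T) (i : Fin m) {A : Set (Vec dy)} (hA : MeasurableSet A) {b : ℝ≥0∞}
    (hb : ∀ μ : Measure (Vec dy), IsSubGaussianVec μ (ν ^ 2) → μ A ≤ b) :
    P {ω | v t i ω ∈ A} ≤ b := by
  have hS : MeasurableSet {u : Fin T → Vec dy | u t ∈ A} := measurable_pi_apply t hA
  have h1 := hM.lintegral_eq i (F := fun y => {u : Fin T → Vec dy | u t ∈ A}.indicator 1 y.2)
    ((measurable_one.indicator hS).comp measurable_snd)
  have h2 : ∫⁻ ω, {u : Fin T → Vec dy | u t ∈ A}.indicator 1 (fun t => v t i ω) ∂P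
      = P {ω | v t i ω ∈ A} := by
    rw [← lintegral_indicator_one (s := {ω | v t i ω ∈ A}) (hM.measurable_noise t i hA)]
    rfl
  rw [← h2, h1]
  calc _ ≤ ∫⁻ _, b ∂D := by
        refine lintegral_mono_ae ?_
        filter_upwards [hM.subGaussian_noise i] with z hz
        rw [lintegral_indicator_one hS]
        have := hb _ (hz t)
        rwa [Measure.map_apply (measurable_pi_apply t) hA] at this
    _ = b := by simp

/-- Conditionally on the input, `⟨v, a⟩` contributes at most `exp(l²ν²‖a‖²/2)`. The value `l =
1/(2ν²)` is the one for which this cancels `exp(-l‖a‖²/4)` exactly. -/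
lemma DataModel.lintegral_exp_noise_le (hM : DataModel P D σ ν x v) [IsProbabilityMeasure D]
    (hν : 0 < ν) {a : Fin T → Vec dx → Vec dy} (ha : ∀ t, Measurable (a t)) (i : Fin m) :
    ∫⁻ ω, ENNReal.ofReal (Real.exp (1 / (2 * (ν : ℝ) ^ 2) *
      ∑ t, (inner ℝ (v t i ω) (a t (x i ω)) - ‖a t (x i ω)‖ ^ 2 / 4))) ∂P ≤ 1 := by
  have hν' : (0 : ℝ) < ν := hν
  set l : ℝ := 1 / (2 * (ν : ℝ) ^ 2) with hl
  have h1 := hM.lintegral_eq i (F := fun y => ENNReal.ofReal (Real.exp (l *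
      ∑ t, (inner ℝ (y.2 t) (a t y.1) - ‖a t y.1‖ ^ 2 / 4)))) (by fun_prop)
  rw [h1]
  calc _ ≤ ∫⁻ _, (1 : ℝ≥0∞) ∂D := by
        refine lintegral_mono_ae ?_
        filter_upwards [hM.subGaussian_noise i, hM.indep_noise i] with z hz hind
        have h2 : ∀ u : Fin T → Vec dy, ENNReal.ofReal (Real.exp (l *
            ∑ t, (inner ℝ (u t) (a t z) - ‖a t z‖ ^ 2 / 4)))
            = ∏ t, ENNReal.ofReal (Real.exp (inner ℝ (u t) (l • a t z) - l * ‖a t z‖ ^ 2 / 4)) := by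
          intro u
          rw [← ENNReal.ofReal_prod_of_nonneg (fun _ _ => (Real.exp_pos _).le), ← Real.exp_sum,
            Finset.mul_sum]
          congr 2
          refine Finset.sum_congr rfl fun t _ => ?_
          rw [inner_smul_right]
          ring
        simp_rw [h2]
        rw [lintegral_prod_eq_prod_lintegral_of_indepFun Finset.univ
          (fun t (u : Fin T → Vec dy) =>
            ENNReal.ofReal (Real.exp (inner ℝ (u t) (l • a t z) - l * ‖a t z‖ ^ 2 / 4)))
          (hind.comp (fun t w =>
            ENNReal.ofReal (Real.exp (inner ℝ w (l • a t z) - l * ‖a t z‖ ^ 2 / 4)))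
            (fun _ => by fun_prop)) (fun _ => by fun_prop)]
        refine Finset.prod_le_one' fun t _ => ?_
        have h3 := (hz t).lintegral_exp_inner_le (l • a t z)
        rw [lintegral_map (by fun_prop) (measurable_pi_apply t)] at h3
        have h4 : ∀ u : Fin T → Vec dy,
            ENNReal.ofReal (Real.exp (inner ℝ (u t) (l • a t z) - l * ‖a t z‖ ^ 2 / 4))
            = ENNReal.ofReal (Real.exp (-(l * ‖a t z‖ ^ 2 / 4)))
              * ENNReal.ofReal (Real.exp (inner ℝ (u t) (l • a t z))) := by
          intro u
          rw [← ENNReal.ofReal_mul (Real.exp_pos _).le, ← Real.exp_add]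
          congr 2
          ring
        simp_rw [h4]
        rw [lintegral_const_mul _ (by fun_prop)]
        refine (mul_le_mul_right h3 _).trans (le_of_eq ?_)
        rw [← ENNReal.ofReal_mul (Real.exp_pos _).le, ← Real.exp_add, ← ENNReal.ofReal_one]
        congr 1
        rw [Real.exp_eq_one_iff, norm_smul, Real.norm_of_nonneg (by positivity), hl]
        push_cast
        field_simp
        ring
    _ = 1 := by simp

lemma DataModel.measure_noise_sum_gt_le (hM : DataModel P D σ ν x v) [IsProbabilityMeasure D]
    (hν : 0 < ν) {a : Fin T → Vec dx → Vec dy} (ha : ∀ t, Measurable (a t)) (L : ℝ) :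
    P {ω | 2 * (ν : ℝ) ^ 2 * L <
      ∑ t, ∑ i, (inner ℝ (v t i ω) (a t (x i ω)) - ‖a t (x i ω)‖ ^ 2 / 4)}
      ≤ ENNReal.ofReal (Real.exp (-L)) := by
  have hν' : (0 : ℝ) < ν := hν
  set l : ℝ := 1 / (2 * (ν : ℝ) ^ 2) with hl
  have hl0 : 0 < l := by positivity
  let F : Vec dx × (Fin T → Vec dy) → ℝ≥0∞ := fun y => ENNReal.ofReal (Real.exp (l *
      ∑ t, (inner ℝ (y.2 t) (a t y.1) - ‖a t y.1‖ ^ 2 / 4)))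
  have hF : Measurable F := by fun_prop
  have hmeas : ∀ i, Measurable fun ω => (x i ω, fun t : Fin T => v t i ω) := fun i =>
    (hM.measurable_input i).prodMk (measurable_pi_lambda _ fun t => hM.measurable_noise t i)
  have hprod : ∫⁻ ω, ∏ i, F (x i ω, fun t : Fin T => v t i ω) ∂P ≤ 1 := by
    rw [lintegral_prod_eq_prod_lintegral_of_indepFun Finset.univ
      (fun i ω => F (x i ω, fun t : Fin T => v t i ω))
      (hM.indep_trajectories.comp (fun _ => F) (fun _ => hF)) (fun i => hF.comp (hmeas i))]
    exact Finset.prod_le_one' fun i _ => hM.lintegral_exp_noise_le hν ha i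
  refine (measure_mono fun ω hω => ?_).trans ((meas_ge_le_lintegral_div
    (ε := ENNReal.ofReal (Real.exp L))
    (Finset.measurable_prod Finset.univ fun i _ => hF.comp (hmeas i)).aemeasurable
    (by simp [Real.exp_pos]) ENNReal.ofReal_ne_top).trans ?_)
  · simp only [Set.mem_ofPred_eq] at hω ⊢
    simp only [Function.comp_def, F]
    rw [← ENNReal.ofReal_prod_of_nonneg (fun _ _ => (Real.exp_pos _).le), ← Real.exp_sum,
      ← Finset.mul_sum, Finset.sum_comm]
    refine ENNReal.ofReal_le_ofReal (Real.exp_le_exp.2 ?_)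
    refine le_trans (le_of_eq ?_) (mul_le_mul_of_nonneg_left hω.le hl0.le)
    rw [hl]
    field_simp
  · refine (ENNReal.div_le_div_right hprod _).trans (le_of_eq ?_)
    rw [← ENNReal.ofReal_one, ← ENNReal.ofReal_div_of_pos (Real.exp_pos _), Real.exp_neg, one_div]

lemma DataModel.measure_input_gt_le (hM : DataModel P D σ ν x v) (hσ : 0 < σ) {r L : ℝ}
    (hr : (σ : ℝ) * (3 + 16 * √(L / dx)) ≤ r) (hL : 0 ≤ L) :
    D {z | r < ‖z‖} ≤ ENNReal.ofReal (Real.exp (-L)) := by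
  have hσ' : (0 : ℝ) < σ := hσ
  have hr0 : 0 ≤ r := le_trans (by positivity) hr
  -- In dimension zero the only vector is `0`, so the event is empty; this case avoids dividing by
  -- `dx`.
  rcases Nat.eq_zero_or_pos dx with rfl | hd
  · have : {z : Vec 0 | r < ‖z‖} = ∅ := by
      ext z
      simp [Subsingleton.elim z 0, hr0]
    simp [this]
  have hd' : (0 : ℝ) < dx := by exact_mod_cast hd
  refine hM.subGaussian_input.measure_norm_gt_le (by positivity) hr0 ?_
  have h1 : √(L / dx) ^ 2 = L / dx := Real.sq_sqrt (by positivity)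
  have h2 : (σ * (3 + 16 * √(L / dx))) ^ 2 ≤ r ^ 2 := by gcongr
  refine le_trans ?_ h2
  push_cast
  have h3 : 2 * ((σ : ℝ) ^ 2 / dx) * dx + 4 * (σ ^ 2 / dx) * L = σ ^ 2 * (2 + 4 * (L / dx)) := by
    field_simp
  rw [h3, mul_pow]
  have h4 : 0 ≤ L / dx := by positivity
  have h5 := Real.sqrt_nonneg (L / dx)
  refine mul_le_mul_of_nonneg_left ?_ (by positivity)
  nlinarith

lemma DataModel.measure_noise_gt_le (hM : DataModel P D σ ν x v) [IsProbabilityMeasure D]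
    (t : Fin T) (i : Fin m) {L : ℝ} (hL : 0 ≤ L) :
    P {ω | 2 * (ν : ℝ) * (√dy + 8 * √(2 * L)) < ‖v t i ω‖} ≤ ENNReal.ofReal (Real.exp (-L)) := by
  refine hM.measure_noise_mem_le t i (A := {w | 2 * (ν : ℝ) * (√dy + 8 * √(2 * L)) < ‖w‖})
    (measurableSet_lt measurable_const measurable_norm) fun μ hμ => ?_
  rcases eq_zero_or_pos ν with rfl | hν
  · rw [zero_pow two_ne_zero] at hμ
    have h0 := hμ.ae_eq_zero
    have : μ {w | 2 * ((0 : ℝ≥0) : ℝ) * (√dy + 8 * √(2 * L)) < ‖w‖} = 0 := by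
      refine measure_mono_null (fun w hw => ?_) (ae_iff.1 h0)
      rintro rfl
      simp at hw
    rw [this]
    exact zero_le
  · have hν' : (0 : ℝ) < ν := hν
    refine hμ.measure_norm_gt_le (by positivity) (by positivity) ?_
    have h1 : √(2 * L) ^ 2 = 2 * L := Real.sq_sqrt (by positivity)
    have h2 : √(dy : ℝ) ^ 2 = dy := Real.sq_sqrt (by positivity)
    have h3 := mul_nonneg (Real.sqrt_nonneg dy) (Real.sqrt_nonneg (2 * L))
    push_cast
    have h4 : 2 * (ν : ℝ) ^ 2 * dy + 4 * ν ^ 2 * L = ν ^ 2 * (2 * dy + 4 * L) := by ring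
    have h5 : (2 * (ν : ℝ) * (√dy + 8 * √(2 * L))) ^ 2
        = ν ^ 2 * (4 * (√dy + 8 * √(2 * L)) ^ 2) := by ring
    rw [h4, h5]
    refine mul_le_mul_of_nonneg_left ?_ (by positivity)
    have : (0 : ℝ) ≤ dy := by positivity
    nlinarith

lemma DataModel.iIndepFun_input (hM : DataModel P D σ ν x v) : iIndepFun x P :=
  hM.indep_trajectories.comp (fun _ => Prod.fst) (fun _ => measurable_fst)

end DataModel

/-! ### Truncation to a set of large measure -/

/-- With mean `a`, the pointwise bound `h ≤ h²/(4Ka) + Ka` limits the integral over `Bᶜ` to `a/4 +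
Ka · D(Bᶜ) ≤ a/2`. -/
lemma integral_le_two_mul_setIntegral {E : Type*} [MeasurableSpace E] {D : Measure E}
    [IsProbabilityMeasure D] {h : E → ℝ} (hint : Integrable h D)
    (hint2 : Integrable (fun z => h z ^ 2) D) {K : ℝ} (hK0 : 0 < K) (hpos : 0 < ∫ z, h z ∂D)
    (hK : ∫ z, h z ^ 2 ∂D ≤ K * (∫ z, h z ∂D) ^ 2) {B : Set E} (hB : MeasurableSet B)
    (hBK : K * D.real Bᶜ ≤ 1 / 4) :
    ∫ z, h z ∂D ≤ 2 * ∫ z in B, h z ∂D := by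
  set a := ∫ z, h z ∂D with ha
  have h1 : ∫ z in Bᶜ, h z ∂D ≤ ∫ z in Bᶜ, (1 / (4 * K * a) * h z ^ 2 + K * a) ∂D := by
    refine integral_mono hint.integrableOn
      ((hint2.integrableOn.const_mul _).add (integrable_const _)) fun z => ?_
    have h3 : 1 / (4 * K * a) * h z ^ 2 + K * a - h z = (h z - 2 * K * a) ^ 2 / (4 * K * a) := by
      field_simp
      ring
    have h4 : 0 ≤ (h z - 2 * K * a) ^ 2 / (4 * K * a) := by positivity
    simp only
    linarith
  have h2 : ∫ z in Bᶜ, (1 / (4 * K * a) * h z ^ 2 + K * a) ∂D ≤ a / 2 := by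
    rw [integral_add (hint2.integrableOn.const_mul _) (integrable_const _), integral_const_mul,
      integral_const]
    have h5 : ∫ z in Bᶜ, h z ^ 2 ∂D ≤ ∫ z, h z ^ 2 ∂D :=
      setIntegral_le_integral hint2 (Filter.Eventually.of_forall fun z => sq_nonneg _)
    have h6 : 1 / (4 * K * a) * ∫ z in Bᶜ, h z ^ 2 ∂D ≤ 1 / (4 * K * a) * (K * a ^ 2) := by
      gcongr
      exact h5.trans hK
    have h7 : 1 / (4 * K * a) * (K * a ^ 2) = a / 4 := by field_simp
    simp only [measureReal_restrict_apply_univ, smul_eq_mul]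
    have h8 : K * D.real Bᶜ * a ≤ 1 / 4 * a := by gcongr
    linarith
  have h9 := integral_add_compl hB hint
  linarith

/-! ### Deterministic analysis of the distillation sequence -/

section Distill

variable {T m p dx dy : ℕ} {g : (t : ℕ) → (Fin t → Vec dx) → Vec dx}
  {f : Vec p → Vec dx → Vec dy} {Θ : Set (Vec p)} {θs : Vec p} {R : Fin T → Finset (Fin m)}
  {reg : Distillation} {x : Fin m → Vec dx} {v : Fin T → Fin m → Vec dy} {θhat : Fin T → Vec p}

lemma distillWeight_pos (t : Fin T) : 0 < distillWeight T t := by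
  unfold distillWeight
  positivity

/-- The basic inequality: the objective at the minimizer is at most that at `θs`. Expanding the
squares cancels `‖v‖²`. -/
lemma IsDistillSequence.minimizer_le {β : Fin T → ℝ}
    (h : IsDistillSequence reg g f Θ R β x (fun t i => f θs (taskInput g t (x i)) + v t i) θhat)
    (hθs : θs ∈ Θ) (τ : Fin T) :
    β τ * ∑ i, (‖directDiff g f θs (θhat τ) τ (x i)‖ ^ 2
        - 2 * inner ℝ (v τ i) (directDiff g f θs (θhat τ) τ (x i)))
      + ∑ s with s < τ, ∑ i ∈ R s, β s * ‖directDiff g f θs (θhat τ) s (x i)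
          - directDiff g f θs (reg.target θhat τ s) s (x i)‖ ^ 2
      ≤ ∑ s with s < τ, ∑ i ∈ R s, β s * ‖directDiff g f θs (reg.target θhat τ s) s (x i)‖ ^ 2 := by
  have h1 := isMinOn_iff.1 (h τ).2 θs hθs
  simp only [distillObjective] at h1
  have h2 : ∀ i, ‖f (θhat τ) (taskInput g τ (x i)) - (f θs (taskInput g τ (x i)) + v τ i)‖ ^ 2
      = (‖directDiff g f θs (θhat τ) τ (x i)‖ ^ 2
        - 2 * inner ℝ (v τ i) (directDiff g f θs (θhat τ) τ (x i))) + ‖v τ i‖ ^ 2 := by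
    intro i
    rw [← sub_sub, norm_sub_sq_real, real_inner_comm]
    rfl
  have h3 : ∀ i, ‖f θs (taskInput g τ (x i)) - (f θs (taskInput g τ (x i)) + v τ i)‖ ^ 2
      = ‖v τ i‖ ^ 2 := by
    intro i
    rw [← sub_sub, sub_self, zero_sub, norm_neg]
  have h4 : ∀ (s : Fin T) i, f (θhat τ) (taskInput g s (x i)) - f (reg.target θhat τ s) (taskInput g s (x i))
      = directDiff g f θs (θhat τ) s (x i)
          - directDiff g f θs (reg.target θhat τ s) s (x i) := by
    intro s i
    simp [directDiff]
  have h5 : ∀ (s : Fin T) i,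
      ‖f θs (taskInput g s (x i)) - f (reg.target θhat τ s) (taskInput g s (x i))‖
      = ‖directDiff g f θs (reg.target θhat τ s) s (x i)‖ := fun s i => norm_sub_rev _ _
  simp only [h2, h3, h4, h5, Finset.sum_add_distrib, mul_add] at h1
  linarith

lemma filter_lt_succ {n : ℕ} (hn : n + 1 < T) :
    (Finset.univ.filter fun s : Fin T => s < ⟨n + 1, hn⟩)
      = insert ⟨n, by omega⟩ (Finset.univ.filter fun s : Fin T => s < ⟨n, by omega⟩) := by
  ext s
  simp only [Finset.mem_filter, Finset.mem_univ, true_and, Finset.mem_insert, Fin.lt_def, Fin.ext_iff]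
  omega

/-- `Q τ` is the weighted error, on the samples stored before task `τ`, of the predictors to be
matched in that task. Both regularizers satisfy the recursion `Q (n+1) ≤ 4 β n * M n + 4 Q n`. -/
lemma IsDistillSequence.weighted_sq_le [NeZero T]
    (h : IsDistillSequence reg g f Θ R (distillWeight T) x
      (fun t i => f θs (taskInput g t (x i)) + v t i) θhat) (hθs : θs ∈ Θ) :
    ∑ t, distillWeight T t * ∑ i ∈ R t, ‖directDiff g f θs (θhat (lastTask T)) t (x i)‖ ^ 2
      ≤ 4 * ∑ t, ∑ i, (inner ℝ (v t i) (directDiff g f θs (θhat t) t (x i))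
          - ‖directDiff g f θs (θhat t) t (x i)‖ ^ 2 / 4) := by
  set β := distillWeight T
  set M : Fin T → ℝ := fun t => ∑ i, (inner ℝ (v t i) (directDiff g f θs (θhat t) t (x i))
          - ‖directDiff g f θs (θhat t) t (x i)‖ ^ 2 / 4) with hM
  set Q : Fin T → ℝ := fun τ => ∑ s with s < τ, ∑ i ∈ R s,
    β s * ‖directDiff g f θs (reg.target θhat τ s) s (x i)‖ ^ 2 with hQ
  set E : Fin T → ℝ := fun τ => ∑ i, ‖directDiff g f θs (θhat τ) τ (x i)‖ ^ 2 with hE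
  have hβ : ∀ t, 0 < β t := distillWeight_pos
  have hER : ∀ τ, ∑ i ∈ R τ, β τ * ‖directDiff g f θs (θhat τ) τ (x i)‖ ^ 2 ≤ β τ * E τ := by
    intro τ
    rw [← Finset.mul_sum]
    refine mul_le_mul_of_nonneg_left ?_ (hβ τ).le
    exact Finset.sum_le_sum_of_subset_of_nonneg (Finset.subset_univ _) fun _ _ _ => by positivity
  have hbase : ∀ τ, β τ * E τ + 2 * ∑ s with s < τ, ∑ i ∈ R s, β s *
      ‖directDiff g f θs (θhat τ) s (x i) - directDiff g f θs (reg.target θhat τ s) s (x i)‖ ^ 2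
      ≤ 4 * β τ * M τ + 2 * Q τ := by
    intro τ
    have h1 := h.minimizer_le hθs τ
    have h2 : ∑ i, (‖directDiff g f θs (θhat τ) τ (x i)‖ ^ 2
        - 2 * inner ℝ (v τ i) (directDiff g f θs (θhat τ) τ (x i))) = E τ / 2 - 2 * M τ := by
      simp only [hE, hM, Finset.sum_sub_distrib, ← Finset.sum_div, ← Finset.mul_sum]
      ring
    rw [h2] at h1
    linarith
  have hcur : ∀ τ, β τ * E τ ≤ 4 * β τ * M τ + 2 * Q τ := by
    intro τ
    refine le_trans (le_add_of_nonneg_right ?_) (hbase τ)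
    exact mul_nonneg zero_le_two (Finset.sum_nonneg fun s _ => Finset.sum_nonneg fun i _ =>
      mul_nonneg (hβ s).le (by positivity))
  -- The inequality `‖a‖² ≤ 2‖a - b‖² + 2‖b‖²` turns closeness to the matched predictor into an
  -- error bound, and raises the factor of `Q` from 2 to 4.
  have hall : ∀ τ, β τ * E τ + ∑ s with s < τ, ∑ i ∈ R s, β s *
      ‖directDiff g f θs (θhat τ) s (x i)‖ ^ 2 ≤ 4 * β τ * M τ + 4 * Q τ := by
    intro τ
    have h1 : ∑ s with s < τ, ∑ i ∈ R s, β s * ‖directDiff g f θs (θhat τ) s (x i)‖ ^ 2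
        ≤ ∑ s with s < τ, ∑ i ∈ R s, (2 * (β s * ‖directDiff g f θs (θhat τ) s (x i)
          - directDiff g f θs (reg.target θhat τ s) s (x i)‖ ^ 2)
          + 2 * (β s * ‖directDiff g f θs (reg.target θhat τ s) s (x i)‖ ^ 2)) := by
      refine Finset.sum_le_sum fun s _ => Finset.sum_le_sum fun i _ => ?_
      set a := directDiff g f θs (θhat τ) s (x i)
      set b := directDiff g f θs (reg.target θhat τ s) s (x i)
      have h2 : ‖a‖ ≤ ‖a - b‖ + ‖b‖ := by simpa using norm_add_le (a - b) b
      have h3 : ‖a‖ ^ 2 ≤ 2 * ‖a - b‖ ^ 2 + 2 * ‖b‖ ^ 2 := by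
        nlinarith [sq_nonneg (‖a - b‖ - ‖b‖), norm_nonneg a]
      nlinarith [mul_le_mul_of_nonneg_left h3 (hβ s).le]
    simp only [Finset.sum_add_distrib, ← Finset.mul_sum] at h1
    have h2 := hbase τ
    simp only [hQ, ← Finset.mul_sum] at h2 ⊢
    linarith
  have hstep : ∀ n (hn : n + 1 < T), Q ⟨n + 1, hn⟩
      ≤ 4 * β ⟨n, by omega⟩ * M ⟨n, by omega⟩ + 4 * Q ⟨n, by omega⟩ := by
    intro n hn
    have hQ0 : 0 ≤ Q ⟨n, by omega⟩ := Finset.sum_nonneg fun s _ => Finset.sum_nonneg fun i _ =>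
      mul_nonneg (hβ s).le (by positivity)
    have hnot : (⟨n, by omega⟩ : Fin T) ∉ Finset.univ.filter fun s : Fin T => s < ⟨n, by omega⟩ := by
      simp
    -- With `latest`, every stored error in the next sum belongs to the predictor just learned, so
    -- `hall` applies. With `taskwise`, the sum only gains the term of task `n`, and `hcur` gives
    -- the factor 3, which is below 4.
    cases reg with
    | latest =>
      refine le_trans ?_ (hall ⟨n, by omega⟩)
      simp only [hQ, Distillation.target, Nat.add_sub_cancel]
      rw [filter_lt_succ hn, Finset.sum_insert hnot]
      gcongr
      exact hER ⟨n, by omega⟩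
    | taskwise =>
      have h1 : Q ⟨n + 1, hn⟩ = ∑ i ∈ R ⟨n, by omega⟩, β ⟨n, by omega⟩ *
          ‖directDiff g f θs (θhat ⟨n, by omega⟩) n (x i)‖ ^ 2 + Q ⟨n, by omega⟩ := by
        simp only [hQ, Distillation.target]
        rw [filter_lt_succ hn, Finset.sum_insert hnot]
      rw [h1]
      linarith [hER ⟨n, by omega⟩, hcur ⟨n, by omega⟩]
  -- Since `β (n+1) = 4 β n`, dividing the recursion by `β (n+1)` leaves the telescoping bound `Q
  -- (n+1) / β (n+1) ≤ M n + Q n / β n`.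
  have hind : ∀ n (hn : n < T), Q ⟨n, hn⟩ ≤ β ⟨n, hn⟩ * ∑ s with s < (⟨n, hn⟩ : Fin T), M s := by
    intro n
    induction n with
    | zero =>
      intro hn
      simp [hQ]
    | succ n ih =>
      intro hn
      have h1 := ih (by omega)
      have h2 : β ⟨n + 1, hn⟩ = 4 * β ⟨n, by omega⟩ := by
        simp only [β, distillWeight]
        rw [show T - 1 - n = (T - 1 - (n + 1)) + 1 by omega, pow_succ]
        ring
      rw [filter_lt_succ hn, Finset.sum_insert (by simp), h2]
      linarith [hstep n hn]
  have hlast : β (lastTask T) = 1 := by simp [β, distillWeight, lastTask]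
  have huniv : (Finset.univ : Finset (Fin T))
      = insert (lastTask T) (Finset.univ.filter fun s : Fin T => s < lastTask T) := by
    ext s
    have := s.2
    simp only [Finset.mem_univ, Finset.mem_insert, Finset.mem_filter, true_and, lastTask,
      Fin.lt_def, Fin.ext_iff, true_iff]
    omega
  have hfin := hall (lastTask T)
  have hQl : Q (lastTask T) ≤ β (lastTask T) * ∑ s with s < lastTask T, M s :=
    hind (T - 1) (lastTask T).2
  have hEl := hER (lastTask T)
  rw [huniv, Finset.sum_insert (by simp), Finset.sum_insert (by simp)]
  simp only [← Finset.mul_sum] at hfin hEl ⊢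
  rw [hlast] at *
  linarith

end Distill

/-! ### Moments of the direct difference maps -/

lemma pos_of_integral_sq_le {E : Type*} [MeasurableSpace E] {D : Measure E} {h : E → ℝ}
    (hint2 : Integrable (fun z => h z ^ 2) D) {K : ℝ} (hpos : 0 < ∫ z, h z ∂D)
    (hK : ∫ z, h z ^ 2 ∂D ≤ K * (∫ z, h z ∂D) ^ 2) : 0 < K := by
  by_contra! hcon
  have h1 : ∫ z, h z ^ 2 ∂D = 0 := le_antisymm
    (hK.trans (mul_nonpos_of_nonpos_of_nonneg hcon (sq_nonneg _)))
    (integral_nonneg fun z => sq_nonneg _)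
  rw [integral_eq_zero_iff_of_nonneg (fun z => sq_nonneg _) hint2] at h1
  have h2 : ∫ z, h z ∂D = 0 := integral_eq_zero_of_ae (h1.mono fun z hz => by simpa using hz)
  linarith

section Predictors

variable {T p dx dy : ℕ} {D : Measure (Vec dx)} {g : (t : ℕ) → (Fin t → Vec dx) → Vec dx}
  {f : Vec p → Vec dx → Vec dy} {Θ : Set (Vec p)} {θs : Vec p} {q LF LG r KG : ℝ}

lemma directDiff_eq_zero {θ : Vec p} (h : f θ = f θs) (t : ℕ) (z : Vec dx) :
    directDiff g f θs θ t z = 0 := by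
  simp [directDiff, h]

lemma LipschitzAssumption.continuous_directDiff
    (h : LipschitzAssumption D g T q f Θ θs LF LG r KG) {θ : Vec p} (hθ : θ ∈ Θ) (t : Fin T) :
    Continuous (directDiff g f θs θ t) :=
  (LipschitzWith.of_dist_le' (K := LG) fun z z' => by
    simpa only [dist_eq_norm] using h.input θ hθ t z z').continuous

lemma LipschitzAssumption.norm_sub_le (h : LipschitzAssumption D g T q f Θ θs LF LG r KG)
    (hKG : 0 ≤ KG) {θ θ' : Vec p} (hθ : θ ∈ Θ) (hθ' : θ' ∈ Θ) (t : Fin T) {z : Vec dx}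
    (hz : ‖z‖ ≤ r) :
    ‖directDiff g f θs θ t z - directDiff g f θs θ' t z‖ ≤ KG * LF * ‖θ - θ'‖ := by
  rw [mul_assoc]
  exact (h.ball θ hθ θ' hθ' t z hz).trans (mul_le_mul_of_nonneg_left (h.param θ hθ θ' hθ') hKG)

lemma LipschitzAssumption.abs_norm_sq_sub_le (h : LipschitzAssumption D g T q f Θ θs LF LG r KG)
    (hKG : 0 ≤ KG) {θ θ' : Vec p} (hθ : θ ∈ Θ) (hθ' : θ' ∈ Θ) (t : Fin T) {z : Vec dx}
    (hz : ‖z‖ ≤ r) :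
    |‖directDiff g f θs θ t z‖ ^ 2 - ‖directDiff g f θs θ' t z‖ ^ 2| ≤ KG * LF * ‖θ - θ'‖ := by
  rw [mul_assoc]
  exact (h.ball_sq θ hθ θ' hθ' t z hz).trans (mul_le_mul_of_nonneg_left (h.param θ hθ θ' hθ') hKG)

lemma MomentAssumption.integrable_sq_sq (h : MomentAssumption D g T f Θ θs) {θ : Vec p}
    (hθ : θ ∈ Θ) (t : Fin T) :
    Integrable (fun z => (‖directDiff g f θs θ t z‖ ^ 2) ^ 2) D := by
  by_cases hne : f θ = f θs
  · simp [directDiff_eq_zero hne]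
  · simpa only [← pow_mul] using (h θ hθ hne t).1

lemma MomentAssumption.integrable_sq [IsFiniteMeasure D] (h : MomentAssumption D g T f Θ θs)
    (hLip : LipschitzAssumption D g T q f Θ θs LF LG r KG) {θ : Vec p} (hθ : θ ∈ Θ) (t : Fin T) :
    Integrable (fun z => ‖directDiff g f θs θ t z‖ ^ 2) D := by
  refine Integrable.mono' ((integrable_const 1).add (h.integrable_sq_sq hθ t))
    ((hLip.continuous_directDiff hθ t).norm.pow 2).aestronglyMeasurable
    (Filter.Eventually.of_forall fun z => ?_)
  rw [Real.norm_of_nonneg (by positivity)]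
  simp only [Pi.add_apply]
  nlinarith [sq_nonneg (‖directDiff g f θs θ t z‖ ^ 2 - 1)]

lemma integral_sq_sq_le_of_momentRatio (h : MomentAssumption D g T f Θ θs)
    (hfin : momentRatio D g T f Θ θs ≠ ⊤) {θ : Vec p} (hθ : θ ∈ Θ) (hne : f θ ≠ f θs)
    (t : Fin T) :
    ∫ z, (‖directDiff g f θs θ t z‖ ^ 2) ^ 2 ∂D
      ≤ (momentRatio D g T f Θ θs).toReal ^ 2 * (∫ z, ‖directDiff g f θs θ t z‖ ^ 2 ∂D) ^ 2 := by
  have hpos := (h θ hθ hne t).2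
  have h1 : ENNReal.ofReal (√(∫ z, ‖directDiff g f θs θ t z‖ ^ 4 ∂D) /
      ∫ z, ‖directDiff g f θs θ t z‖ ^ 2 ∂D) ≤ momentRatio D g T f Θ θs :=
    le_iSup_of_le θ (le_iSup_of_le hθ (le_iSup_of_le hne
      (le_iSup (fun t : Fin T => ENNReal.ofReal (√(∫ z, ‖directDiff g f θs θ t z‖ ^ 4 ∂D) /
        ∫ z, ‖directDiff g f θs θ t z‖ ^ 2 ∂D)) t)))
  have h2 := (ENNReal.ofReal_le_iff_le_toReal hfin).1 h1
  rw [div_le_iff₀ hpos] at h2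
  simp only [← pow_mul]
  rw [← mul_pow, ← Real.sq_sqrt (integral_nonneg fun z => by positivity :
    0 ≤ ∫ z, ‖directDiff g f θs θ t z‖ ^ (2 * 2) ∂D)]
  exact pow_le_pow_left₀ (Real.sqrt_nonneg _) h2 2

/-- Parameter closeness controls the difference maps only on the ball, so the integral is first
truncated there at the price of a factor 2. -/
lemma integral_sq_le_of_dist_le [IsProbabilityMeasure D] (h : MomentAssumption D g T f Θ θs)
    (hLip : LipschitzAssumption D g T q f Θ θs LF LG r KG) (hKG : 0 ≤ KG) (hLF : 0 ≤ LF)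
    (hfin : momentRatio D g T f Θ θs ≠ ⊤)
    (hr : (momentRatio D g T f Θ θs).toReal ^ 2 * D.real {z | r < ‖z‖} ≤ 1 / 4)
    {θ θ' : Vec p} (hθ : θ ∈ Θ) (hθ' : θ' ∈ Θ) {ε : ℝ} (hε : ‖θ - θ'‖ ≤ ε) (t : Fin T) :
    ∫ z, ‖directDiff g f θs θ t z‖ ^ 2 ∂D
      ≤ 2 * (∫ z, ‖directDiff g f θs θ' t z‖ ^ 2 ∂D + KG * LF * ε) := by
  have hε0 : 0 ≤ ε := (norm_nonneg _).trans hε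
  by_cases hne : f θ = f θs
  · have h1 : 0 ≤ ∫ z, ‖directDiff g f θs θ' t z‖ ^ 2 ∂D := integral_nonneg fun z => by positivity
    simp only [directDiff_eq_zero hne, norm_zero, ne_eq, OfNat.ofNat_ne_zero, not_false_eq_true,
      zero_pow, integral_zero]
    positivity
  have hint := h.integrable_sq hLip hθ t
  have hint' := h.integrable_sq hLip hθ' t
  have hK := integral_sq_sq_le_of_momentRatio h hfin hθ hne t
  have hpos := (h θ hθ hne t).2
  have hK0 := pos_of_integral_sq_le (h.integrable_sq_sq hθ t) hpos hK
  have hcompl : {z : Vec dx | ‖z‖ ≤ r}ᶜ = {z | r < ‖z‖} := by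
    ext z
    simp
  have hB : MeasurableSet {z : Vec dx | ‖z‖ ≤ r} := measurableSet_le measurable_norm measurable_const
  have h1 := integral_le_two_mul_setIntegral hint (h.integrable_sq_sq hθ t) hK0 hpos hK
    hB (by rwa [hcompl])
  have h2 : ∫ z in {z : Vec dx | ‖z‖ ≤ r}, ‖directDiff g f θs θ t z‖ ^ 2 ∂D
      ≤ ∫ z in {z : Vec dx | ‖z‖ ≤ r}, (‖directDiff g f θs θ' t z‖ ^ 2 + KG * LF * ε) ∂D := by
    refine setIntegral_mono_on hint.integrableOn (hint'.integrableOn.add (integrable_const _)) hB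
      fun z hz => ?_
    have h3 := (abs_le.1 (hLip.abs_norm_sq_sub_le hKG hθ hθ' t hz)).2
    have h4 : KG * LF * ‖θ - θ'‖ ≤ KG * LF * ε := by gcongr
    linarith
  have h3 : ∫ z in {z : Vec dx | ‖z‖ ≤ r}, (‖directDiff g f θs θ' t z‖ ^ 2 + KG * LF * ε) ∂D
      ≤ ∫ z, (‖directDiff g f θs θ' t z‖ ^ 2 + KG * LF * ε) ∂D :=
    setIntegral_le_integral (hint'.add (integrable_const _))
      (Filter.Eventually.of_forall fun z => by positivity)
  rw [integral_add hint' (integrable_const _)] at h3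
  simp only [integral_const, probReal_univ, smul_eq_mul, one_mul] at h3
  linarith

end Predictors

/-! ### Weights -/

lemma weightedError_eq_div {T m p dx dy : ℕ} {D : Measure (Vec dx)}
    {g : (t : ℕ) → (Fin t → Vec dx) → Vec dx} {f : Vec p → Vec dx → Vec dy} {θs : Vec p}
    {R : Fin T → Finset (Fin m)} {θ : Vec p} :
    weightedError D g f θs R θ = (∑ t : Fin T, distillWeight T t * ((R t).card *
      ∫ z, ‖directDiff g f θs θ t z‖ ^ 2 ∂D)) / totalWeight R := by
  rw [weightedError, Finset.sum_div]
  refine Finset.sum_congr rfl fun t _ => ?_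
  simp only [directDiff, norm_sub_rev (f θ _)]
  ring

lemma distillWeight_le_one {T : ℕ} (t : Fin T) : distillWeight T t ≤ 1 :=
  pow_le_one₀ (by norm_num) (by norm_num)

lemma totalWeight_nonneg {T m : ℕ} (R : Fin T → Finset (Fin m)) : 0 ≤ totalWeight R :=
  Finset.sum_nonneg fun t _ => mul_nonneg (distillWeight_pos t).le (Nat.cast_nonneg _)

lemma sum_distillWeight_le {T : ℕ} : ∑ t, distillWeight T t ≤ 2 := by
  have h1 : ∑ t, distillWeight T t = ∑ i ∈ Finset.range T, (1 / 4 : ℝ) ^ i := by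
    rw [← Finset.sum_range_reflect, ← Fin.sum_univ_eq_sum_range (fun i => (1 / 4 : ℝ) ^ (T - 1 - i))]
    rfl
  rw [h1]
  refine (Summable.sum_le_tsum _ (fun _ _ => by positivity)
    (summable_geometric_of_lt_one (by norm_num) (by norm_num))).trans ?_
  rw [tsum_geometric_of_lt_one (by norm_num) (by norm_num)]
  norm_num

lemma measure_iUnion_le_card_mul {Ω ι : Type*} [MeasurableSpace Ω] [Fintype ι] {P : Measure Ω}
    {S : ι → Set Ω} {b : ℝ} (hS : ∀ i, P (S i) ≤ ENNReal.ofReal b) :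
    P (⋃ i, S i) ≤ ENNReal.ofReal (Fintype.card ι * b) := by
  refine (measure_iUnion_fintype_le P S).trans ((Finset.sum_le_sum fun i _ => hS i).trans ?_)
  rw [Finset.sum_const, Finset.card_univ, nsmul_eq_mul, ENNReal.ofReal_mul (Nat.cast_nonneg _),
    ENNReal.ofReal_natCast]

/-! ### The error bound on the good event -/

section Bound

variable {T m p dx dy : ℕ} {D : Measure (Vec dx)}
  {g : (t : ℕ) → (Fin t → Vec dx) → Vec dx} {f : Vec p → Vec dx → Vec dy} {Θ : Set (Vec p)}
  {θs : Vec p} {q LF LG r rv KG ε : ℝ} {R : Fin T → Finset (Fin m)} {reg : Distillation}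

lemma sum_noise_sub_le_of_net (hLip : LipschitzAssumption D g T q f Θ θs LF LG r KG)
    (hKG : 0 ≤ KG) (hLF : 0 ≤ LF) (hrv : 0 ≤ rv) (hε : 0 ≤ ε) {θ θ' : Fin T → Vec p}
    (hθ : ∀ t, θ t ∈ Θ) (hθ' : ∀ t, θ' t ∈ Θ) (hd : ∀ t, ‖θ t - θ' t‖ ≤ ε)
    {x : Fin m → Vec dx} {v : Fin T → Fin m → Vec dy} (hx : ∀ i, ‖x i‖ ≤ r)
    (hv : ∀ t i, ‖v t i‖ ≤ rv) :
    ∑ t, ∑ i, (inner ℝ (v t i) (directDiff g f θs (θ t) t (x i))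
        - ‖directDiff g f θs (θ t) t (x i)‖ ^ 2 / 4)
      ≤ ∑ t, ∑ i, (inner ℝ (v t i) (directDiff g f θs (θ' t) t (x i))
        - ‖directDiff g f θs (θ' t) t (x i)‖ ^ 2 / 4)
        + T * m * (KG * LF * ε * (1 + rv)) := by
  have h1 : ∀ (t : Fin T) i, inner ℝ (v t i) (directDiff g f θs (θ t) t (x i))
        - ‖directDiff g f θs (θ t) t (x i)‖ ^ 2 / 4
      ≤ inner ℝ (v t i) (directDiff g f θs (θ' t) t (x i))
        - ‖directDiff g f θs (θ' t) t (x i)‖ ^ 2 / 4 + KG * LF * ε * (1 + rv) := by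
    intro t i
    have h2 : KG * LF * ‖θ t - θ' t‖ ≤ KG * LF * ε := mul_le_mul_of_nonneg_left (hd t) (by positivity)
    have h3 := (abs_le.1 (hLip.abs_norm_sq_sub_le hKG (hθ t) (hθ' t) t (hx i))).1
    have h4 := hLip.norm_sub_le hKG (hθ t) (hθ' t) t (hx i)
    have h5 := real_inner_le_norm (v t i)
      (directDiff g f θs (θ t) t (x i) - directDiff g f θs (θ' t) t (x i))
    rw [inner_sub_right] at h5
    have h6 := mul_le_mul (hv t i) (h4.trans h2) (norm_nonneg _) hrv
    have h7 : 0 ≤ KG * LF * ε := by positivity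
    linarith
  refine (Finset.sum_le_sum fun t _ => Finset.sum_le_sum fun i _ => h1 t i).trans (le_of_eq ?_)
  simp only [Finset.sum_add_distrib, Finset.sum_const, Finset.card_univ, Fintype.card_fin,
    nsmul_eq_mul]
  ring

lemma sum_weight_card_integral_le [NeZero T] [IsProbabilityMeasure D] (hMom : MomentAssumption D g T f Θ θs)
    (hLip : LipschitzAssumption D g T q f Θ θs LF LG r KG) (hKG : 0 ≤ KG) (hLF : 0 ≤ LF)
    (hrv : 0 ≤ rv) (hε : 0 ≤ ε) (hθs : θs ∈ Θ)
    (hfin : momentRatio D g T f Θ θs ≠ ⊤)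
    (hr : (momentRatio D g T f Θ θs).toReal ^ 2 * D.real {z | r < ‖z‖} ≤ 1 / 4)
    {N : Finset (Vec p)} (hN : (N : Set (Vec p)) ⊆ Θ) (hnet : ∀ θ ∈ Θ, ∃ θ' ∈ N, ‖θ - θ'‖ ≤ ε)
    {x : Fin m → Vec dx} {v : Fin T → Fin m → Vec dy} {θhat : Fin T → Vec p}
    (hx : ∀ i, ‖x i‖ ≤ r) (hv : ∀ t i, ‖v t i‖ ≤ rv) {U : ℝ}
    (hU : ∀ θ : Fin T → N, ∑ t, ∑ i, (inner ℝ (v t i) (directDiff g f θs (θ t) t (x i))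
        - ‖directDiff g f θs (θ t) t (x i)‖ ^ 2 / 4) ≤ U)
    (hlow : ∀ t, ∀ θ ∈ N, (R t).card * (∫ z, ‖directDiff g f θs θ t z‖ ^ 2 ∂D) / 2
      ≤ ∑ i ∈ R t, ‖directDiff g f θs θ t (x i)‖ ^ 2)
    (hseq : IsDistillSequence reg g f Θ R (distillWeight T) x
      (fun t i => f θs (taskInput g t (x i)) + v t i) θhat) :
    ∑ t : Fin T, distillWeight T t * ((R t).card *
      ∫ z, ‖directDiff g f θs (θhat (lastTask T)) t z‖ ^ 2 ∂D)
      ≤ 16 * U + 22 * (T * m * (KG * LF * ε * (1 + rv))) := by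
  set e := KG * LF * ε with he
  have he0 : 0 ≤ e := by positivity
  have hΘ : ∀ t, θhat t ∈ Θ := fun t => (hseq t).1
  choose η hηN hηε using fun t => hnet (θhat t) (hΘ t)
  have h1 := hseq.weighted_sq_le hθs
  have h2 := sum_noise_sub_le_of_net hLip hKG hLF hrv hε hΘ (fun t => hN (hηN t)) hηε hx hv
  have h3 := hU fun t => ⟨η t, hηN t⟩
  have h4 : ∀ t : Fin T, distillWeight T t * ((R t).card *
      ∫ z, ‖directDiff g f θs (θhat (lastTask T)) t z‖ ^ 2 ∂D)
      ≤ 4 * (distillWeight T t *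
        ∑ i ∈ R t, ‖directDiff g f θs (θhat (lastTask T)) t (x i)‖ ^ 2) + 6 * (m * e) := by
    intro t
    set θ := θhat (lastTask T)
    set θ' := η (lastTask T)
    have hd : ‖θ - θ'‖ ≤ ε := hηε (lastTask T)
    have hθ : θ ∈ Θ := hΘ _
    have hθ' : θ' ∈ Θ := hN (hηN _)
    have h5 := integral_sq_le_of_dist_le hMom hLip hKG hLF hfin hr hθ hθ' hd t
    have h6 := hlow t θ' (hηN _)
    have h7 : ∑ i ∈ R t, ‖directDiff g f θs θ' t (x i)‖ ^ 2
        ≤ ∑ i ∈ R t, (‖directDiff g f θs θ t (x i)‖ ^ 2 + e) := by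
      refine Finset.sum_le_sum fun i _ => ?_
      have h8 := (abs_le.1 (hLip.abs_norm_sq_sub_le hKG hθ hθ' t (hx i))).1
      have h9 : KG * LF * ‖θ - θ'‖ ≤ e := mul_le_mul_of_nonneg_left hd (by positivity)
      linarith
    rw [Finset.sum_add_distrib, Finset.sum_const, nsmul_eq_mul] at h7
    have hc : ((R t).card : ℝ) ≤ m := by
      exact_mod_cast (Finset.card_le_univ (R t)).trans (by simp)
    -- Population error at `θ`, then at the net point `θ'`, then empirical error at `θ'`, then at
    -- `θ`: the two factors 2 multiply to 4, and the net errors add up to `2e + 4e` per sample.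
    have h10 : (R t).card * ∫ z, ‖directDiff g f θs θ t z‖ ^ 2 ∂D
        ≤ 4 * ∑ i ∈ R t, ‖directDiff g f θs θ t (x i)‖ ^ 2 + 6 * (m * e) := by
      have h11 := mul_le_mul_of_nonneg_left h5 (Nat.cast_nonneg (α := ℝ) (R t).card)
      have h12 := mul_le_mul_of_nonneg_right hc he0
      linarith
    have hβ := distillWeight_pos t
    have hβ1 := distillWeight_le_one t
    have h13 := mul_le_mul_of_nonneg_left h10 hβ.le
    have h14 := mul_le_mul_of_nonneg_right hβ1 (by positivity : 0 ≤ 6 * (m * e))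
    linarith
  have h15 := Finset.sum_le_sum fun t (_ : t ∈ Finset.univ) => h4 t
  rw [Finset.sum_add_distrib, ← Finset.mul_sum, Finset.sum_const, Finset.card_univ,
    Fintype.card_fin, nsmul_eq_mul] at h15
  have h16 : (T : ℝ) * (m * e) ≤ T * m * (e * (1 + rv)) := by
    have : 0 ≤ (T : ℝ) * m * (e * rv) := by positivity
    linarith
  linarith

end Bound

/-! ### The probability of the good event -/

lemma log_le_of_le_pow {n A : ℝ} {p : ℕ} (hn : 1 ≤ n) (hA : 0 ≤ A) (h : n ≤ (1 + 2 * A) ^ p) :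
    Real.log n ≤ 2 * (p * Real.log (1 + A)) := by
  have h1 : n ≤ ((1 + A) ^ 2) ^ p :=
    h.trans (pow_le_pow_left₀ (by positivity) (by nlinarith [sq_nonneg A]) p)
  have h2 := Real.log_le_log (by linarith) h1
  rw [Real.log_pow, Real.log_pow] at h2
  push_cast at h2
  linarith

lemma one_le_log_four_div {δ : ℝ} (hδ : 0 < δ) (hδ1 : δ < 1) : 1 ≤ Real.log (4 / δ) := by
  rw [Real.le_log_iff_exp_le (by positivity), le_div_iff₀ hδ]
  nlinarith [Real.exp_one_lt_d9, Real.exp_pos 1]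

section GoodEvent

variable {T m p dx dy : ℕ} {Ω : Type*} [MeasurableSpace Ω] {P : Measure Ω}
  {D : Measure (Vec dx)} {σ ν : ℝ≥0}
  {x : Fin m → Ω → Vec dx} {v : Fin T → Fin m → Ω → Vec dy}
  {g : (t : ℕ) → (Fin t → Vec dx) → Vec dx} {f : Vec p → Vec dx → Vec dy} {Θ : Set (Vec p)}
  {θs : Vec p} {q LF LG r rv KG ε δ : ℝ} {R : Fin T → Finset (Fin m)} {reg : Distillation}
  {θhat : Fin T → Ω → Vec p}

lemma measure_iUnion_noise_le (hT : 0 < T) (hm : 0 < m)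
    (hv : ∀ t i, P {ω | rv < ‖v t i ω‖} ≤ ENNReal.ofReal (δ / (4 * T * m))) :
    P (⋃ y : Fin T × Fin m, {ω | rv < ‖v y.1 y.2 ω‖}) ≤ ENNReal.ofReal (δ / 4) := by
  have hm' : (m : ℝ) ≠ 0 := by positivity
  have hT' : (T : ℝ) ≠ 0 := by positivity
  refine (measure_iUnion_le_card_mul (S := fun y : Fin T × Fin m => {ω | rv < ‖v y.1 y.2 ω‖})
    fun y => hv y.1 y.2).trans (le_of_eq ?_)
  rw [Fintype.card_prod, Fintype.card_fin, Fintype.card_fin]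
  congr 1
  push_cast
  field_simp

variable [IsProbabilityMeasure P]

lemma DataModel.measure_iUnion_input_le (hM : DataModel P D σ ν x v) (hm : 0 < m)
    (hx : D {z | r < ‖z‖} ≤ ENNReal.ofReal (δ / (4 * m))) :
    P (⋃ i, {ω | r < ‖x i ω‖}) ≤ ENNReal.ofReal (δ / 4) := by
  have hm' : (m : ℝ) ≠ 0 := by positivity
  refine (measure_iUnion_le_card_mul (b := δ / (4 * m)) fun i => ?_).trans (le_of_eq ?_)
  · have h := hM.law_input i
    rw [← h, Measure.map_apply (hM.measurable_input i)
      (measurableSet_lt measurable_const measurable_norm)] at hx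
    exact hx
  · rw [Fintype.card_fin]
    congr 1
    field_simp

variable [IsProbabilityMeasure D]

lemma DataModel.measure_empirical_lt_le (hM : DataModel P D σ ν x v)
    (hMom : MomentAssumption D g T f Θ θs)
    (hLip : LipschitzAssumption D g T q f Θ θs LF LG r KG)
    (hfin : momentRatio D g T f Θ θs ≠ ⊤) {θ : Vec p} (hθ : θ ∈ Θ) (t : Fin T) {L : ℝ}
    (hL : 8 * (momentRatio D g T f Θ θs).toReal ^ 2 * L ≤ (R t).card) :
    P {ω | ∑ i ∈ R t, ‖directDiff g f θs θ t (x i ω)‖ ^ 2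
        < (R t).card * (∫ z, ‖directDiff g f θs θ t z‖ ^ 2 ∂D) / 2}
      ≤ ENNReal.ofReal (Real.exp (-L)) := by
  by_cases hne : f θ = f θs
  · simp [directDiff_eq_zero hne]
  have hpos := (hMom θ hθ hne t).2
  have hK := integral_sq_sq_le_of_momentRatio hMom hfin hθ hne t
  have hK0 := pos_of_integral_sq_le (hMom.integrable_sq_sq hθ t) hpos hK
  refine (measure_sum_lt_half_le hM.measurable_input hM.law_input hM.iIndepFun_input
    ((hLip.continuous_directDiff hθ t).norm.pow 2).measurable (fun z => sq_nonneg _)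
    (hMom.integrable_sq hLip hθ t) (hMom.integrable_sq_sq hθ t) hpos hK hK0 (R t)).trans ?_
  refine ENNReal.ofReal_le_ofReal (Real.exp_le_exp.2 (neg_le_neg ?_))
  rw [le_div_iff₀ (by positivity)]
  linarith

/-- Union bound over the `|N| ^ T` tuples. The conjunct `0 < ν` empties the events in the noiseless
case, where the exponent `1/(2ν²)` is meaningless. -/
lemma DataModel.measure_iUnion_noise_sum_le (hM : DataModel P D σ ν x v)
    (hLip : LipschitzAssumption D g T q f Θ θs LF LG r KG) (hδ : 0 < δ) {N : Finset (Vec p)}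
    (hN : (N : Set (Vec p)) ⊆ Θ) (hN0 : N.Nonempty) :
    P (⋃ θ : Fin T → N, {ω | 0 < ν ∧ 2 * (ν : ℝ) ^ 2 * (T * Real.log N.card + Real.log (4 / δ)) <
      ∑ t, ∑ i, (inner ℝ (v t i ω) (directDiff g f θs (θ t) t (x i ω))
        - ‖directDiff g f θs (θ t) t (x i ω)‖ ^ 2 / 4)}) ≤ ENNReal.ofReal (δ / 4) := by
  have hNc : (0 : ℝ) < N.card := by exact_mod_cast hN0.card_pos
  refine (measure_iUnion_le_card_mul
    (b := Real.exp (-(T * Real.log N.card + Real.log (4 / δ)))) fun θ => ?_).trans (le_of_eq ?_)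
  · rcases eq_zero_or_pos ν with h0 | hν
    · simp [h0]
    · simp only [hν, true_and]
      exact hM.measure_noise_sum_gt_le hν (a := fun t => directDiff g f θs (θ t) t)
        (fun t => (hLip.continuous_directDiff (hN (θ t).2) t).measurable) _
  · rw [Fintype.card_fun, Fintype.card_fin, Fintype.card_coe, neg_add, Real.exp_add,
      Real.exp_neg (Real.log _), Real.exp_log (by positivity), ← mul_neg,
      Real.exp_nat_mul, Real.exp_neg, Real.exp_log hNc]
    congr 1
    push_cast
    rw [inv_div, ← mul_assoc, ← mul_pow, mul_inv_cancel₀ hNc.ne', one_pow, one_mul]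

lemma DataModel.measure_iUnion_empirical_le (hM : DataModel P D σ ν x v)
    (hMom : MomentAssumption D g T f Θ θs)
    (hLip : LipschitzAssumption D g T q f Θ θs LF LG r KG) (hT : 0 < T) (hδ : 0 < δ)
    (hfin : momentRatio D g T f Θ θs ≠ ⊤) {N : Finset (Vec p)}
    (hN : (N : Set (Vec p)) ⊆ Θ) (hN0 : N.Nonempty)
    (hcard : ∀ t, 8 * (momentRatio D g T f Θ θs).toReal ^ 2 *
      (Real.log T + Real.log N.card + Real.log (4 / δ)) ≤ (R t).card) :
    P (⋃ y : Fin T × N, {ω | ∑ i ∈ R y.1, ‖directDiff g f θs y.2 y.1 (x i ω)‖ ^ 2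
      < (R y.1).card * (∫ z, ‖directDiff g f θs y.2 y.1 z‖ ^ 2 ∂D) / 2})
      ≤ ENNReal.ofReal (δ / 4) := by
  have hT' : (0 : ℝ) < T := by positivity
  have hNc : (0 : ℝ) < N.card := by exact_mod_cast hN0.card_pos
  refine (measure_iUnion_le_card_mul fun y : Fin T × N =>
    hM.measure_empirical_lt_le hMom hLip hfin (hN y.2.2) y.1 (hcard y.1)).trans (le_of_eq ?_)
  rw [Fintype.card_prod, Fintype.card_fin, Fintype.card_coe, Real.exp_neg, Real.exp_add,
    Real.exp_add, Real.exp_log hT', Real.exp_log hNc, Real.exp_log (by positivity)]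
  congr 1
  push_cast
  field_simp

/-- Four bad events of probability at most `δ/4` each (large input, large noise, noise correlation,
empirical lower tail), and a null set. Outside them the bound is deterministic, so no measurability
of `θhat` is required. -/
lemma exists_good_event [NeZero T] (hM : DataModel P D σ ν x v) (hMom : MomentAssumption D g T f Θ θs)
    (hLip : LipschitzAssumption D g T q f Θ θs LF LG r KG) (hKG : 0 ≤ KG) (hLF : 0 ≤ LF)
    (hm : 0 < m) (hδ : 0 < δ) (hrv : 0 ≤ rv) (hrν : ν = 0 → rv = 0) (hε : 0 ≤ ε) (hθs : θs ∈ Θ)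
    (hfin : momentRatio D g T f Θ θs ≠ ⊤)
    (hr : (momentRatio D g T f Θ θs).toReal ^ 2 * D.real {z | r < ‖z‖} ≤ 1 / 4)
    {N : Finset (Vec p)} (hN : (N : Set (Vec p)) ⊆ Θ) (hN0 : N.Nonempty)
    (hnet : ∀ θ ∈ Θ, ∃ θ' ∈ N, ‖θ - θ'‖ ≤ ε)
    (hx : D {z | r < ‖z‖} ≤ ENNReal.ofReal (δ / (4 * m)))
    (hv : ∀ t i, P {ω | rv < ‖v t i ω‖} ≤ ENNReal.ofReal (δ / (4 * T * m)))
    (hcard : ∀ t, 8 * (momentRatio D g T f Θ θs).toReal ^ 2 *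
      (Real.log T + Real.log N.card + Real.log (4 / δ)) ≤ (R t).card)
    (hseq : ∀ᵐ ω ∂P, IsDistillSequence reg g f Θ R (distillWeight T) (fun i => x i ω)
          (fun t i => f θs (taskInput g t (x i ω)) + v t i ω) (fun t => θhat t ω)) :
    P {ω | ¬ ∑ t : Fin T, distillWeight T t * ((R t).card *
        ∫ z, ‖directDiff g f θs (θhat (lastTask T) ω) t z‖ ^ 2 ∂D)
      ≤ 16 * (2 * (ν : ℝ) ^ 2 * (T * Real.log N.card + Real.log (4 / δ)))
        + 22 * (T * m * (KG * LF * ε * (1 + rv)))} ≤ ENNReal.ofReal δ := by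
  have hT : 0 < T := Nat.pos_of_ne_zero (NeZero.ne T)
  have h1 := hM.measure_iUnion_input_le hm hx
  have h2 := measure_iUnion_noise_le hT hm hv
  have h3 := hM.measure_iUnion_noise_sum_le hLip hδ hN hN0
  have h4 := hM.measure_iUnion_empirical_le hMom hLip hT hδ hfin hN hN0 hcard
  have h5 := ae_iff.1 hseq
  refine (measure_mono (fun ω hω => ?_)).trans ((measure_union_le _ _).trans
    ((add_le_add ((measure_union_le _ _).trans (add_le_add ((measure_union_le _ _).trans
      (add_le_add h1 h2)) ((measure_union_le _ _).trans (add_le_add h3 h4)))) h5.le).trans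
      (le_of_eq ?_)))
  · by_contra hcon
    simp only [Set.mem_union, not_or] at hcon
    obtain ⟨⟨⟨g1, g2⟩, g3, g4⟩, g5⟩ := hcon
    simp only [Set.mem_iUnion, Set.mem_ofPred_eq, not_exists, not_lt,
      not_and, not_not] at g1 g2 g3 g4 g5
    refine hω (sum_weight_card_integral_le (x := fun i => x i ω) (v := fun t i => v t i ω)
      (θhat := fun t => θhat t ω) hMom hLip hKG hLF hrv hε hθs hfin hr hN hnet g1
      (fun t i => g2 (t, i)) (fun θ => ?_) (fun t θ hθ => g4 (t, ⟨θ, hθ⟩)) g5)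
    -- Without noise, `rv = 0` forces every `v t i ω` to vanish, so the sum is nonpositive.
    rcases eq_zero_or_pos ν with h0 | hν
    · have hv0 : ∀ t i, v t i ω = 0 := fun t i => norm_le_zero_iff.1 (hrν h0 ▸ g2 (t, i))
      simp only [hv0, h0, inner_zero_left, zero_sub, NNReal.coe_zero]
      refine (Finset.sum_nonpos fun t _ => Finset.sum_nonpos fun i _ => ?_).trans (by simp)
      have : 0 ≤ ‖directDiff g f θs (θ t) t (x i ω)‖ ^ 2 := by positivity
      linarith
    · exact g3 θ hν
  · rw [add_zero, ← ENNReal.ofReal_add (by positivity) (by positivity),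
      ← ENNReal.ofReal_add (by positivity) (by positivity)]
    congr 1
    ring

end GoodEvent

end ContinualLearning

/-! ### The main theorem: choice of constants and net radius -/

open ContinualLearning in
theorem theorem2 :
    ∃ c : ℝ, 0 < c ∧
      ∀ (T m p dx dy : ℕ) [NeZero T]
        {Ω : Type*} [MeasurableSpace Ω] (P : Measure Ω) [IsProbabilityMeasure P]
        (D : Measure (Vec dx)) [IsProbabilityMeasure D]
        (σ ν : ℝ≥0) (x : Fin m → Ω → Vec dx) (v : Fin T → Fin m → Ω → Vec dy)
        (g : (t : ℕ) → (Fin t → Vec dx) → Vec dx)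
        (f : Vec p → Vec dx → Vec dy) (Θ : Set (Vec p)) (θs : Vec p)
        (q LF LG kG α δ : ℝ)
        (R : Fin T → Finset (Fin m))
        (reg : Distillation) (θhat : Fin T → Ω → Vec p),
        0 < δ → δ < 1 → 0 < σ → 1 ≤ q → 0 < LF → 0 < LG → 0 < kG → 0 < α →
        DataModel P D σ ν x v →
        (∀ t, Measurable (g t)) →
        Bornology.IsBounded Θ → θs ∈ Θ →
        (∀ θ ∈ Θ, ∀ t : Fin T,
          MemLp (fun z => f θ (taskInput g t z)) (ENNReal.ofReal q) D) →
        MomentAssumption D g T f Θ θs →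
        LipschitzAssumption D g T q f Θ θs LF LG
          (inputRadius T m dx δ σ LF LG kG α (Metric.diam Θ))
          (kG * inputRadius T m dx δ σ LF LG kG α (Metric.diam Θ) ^ α) →
        R (lastTask T) = Finset.univ →
        (∀ t : Fin T,
          momentRatio D g T f Θ θs ^ 2 * ENNReal.ofReal
              (c * (p * netLog T m dy δ ν LF (Metric.diam Θ) + Real.log (4 / δ)))
            ≤ ((R t).card : ℝ≥0∞)) →
        (∀ᵐ ω ∂P, IsDistillSequence reg g f Θ R (distillWeight T) (fun i => x i ω)
          (fun t i => f θs (taskInput g t (x i ω)) + v t i ω) (fun t => θhat t ω)) →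
        P {ω | ¬ weightedError D g f θs R (θhat (lastTask T) ω) ≤
            c * ((ν : ℝ) ^ 2 *
                  (p * T * netLog T m dy δ ν LF (Metric.diam Θ) + Real.log (4 / δ)) +
                kG * inputRadius T m dx δ σ LF LG kG α (Metric.diam Θ) ^ α) /
              totalWeight R}
          ≤ ENNReal.ofReal δ := by
  -- The noise term fixes the constant: `16 · 2ν²` from `exists_good_event`, times the 2 in `log |N|
  -- ≤ 2pℓ`.
  refine ⟨64, by norm_num, ?_⟩
  intro T m p dx dy _ Ω _ P _ D _ σ ν x v g f Θ θs q LF LG kG α δ R reg θhat hδ hδ1 hσ _ hLF hLG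
    hkG hα hM _ hΘ hθs _ hMom hLip _ hsize hseq
  -- Without samples both sides are zero, the right one because division by zero gives zero.
  rcases Nat.eq_zero_or_pos m with rfl | hm
  · have hR : ∀ t, R t = ∅ := fun t => Finset.eq_empty_of_isEmpty _
    simp [weightedError, totalWeight, hR]
  set Δ := Metric.diam Θ with hΔ
  have hΔ0 : 0 ≤ Δ := Metric.diam_nonneg
  have hT : (1 : ℝ) ≤ T := by exact_mod_cast Nat.pos_of_ne_zero (NeZero.ne T)
  have hm' : (1 : ℝ) ≤ m := by exact_mod_cast hm
  have hσ' : (0 : ℝ) < σ := hσ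
  have hTm : (1 : ℝ) ≤ T * m := one_le_mul_of_one_le_of_one_le hT hm'
  have hδTm : 1 ≤ 4 * T * m / δ := by
    rw [le_div_iff₀ hδ]
    linarith
  set Lg := Real.log (4 * T * m / δ) with hLg
  have hLg0 : 0 ≤ Lg := Real.log_nonneg hδTm
  have hexp : Real.exp (-Lg) = δ / (4 * T * m) := by
    rw [Real.exp_neg, Real.exp_log (by positivity), inv_div]
  have hΛ : Lg ≤ Real.log (4 * T * m / δ * (1 + LG * σ * LF * Δ) *
      (1 + LG ^ 2 * σ ^ 2 / (kG * (σ : ℝ) ^ α))) := by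
    refine Real.log_le_log (by positivity) ?_
    have h1 : 1 ≤ 1 + LG * σ * LF * Δ := le_add_of_nonneg_right (by positivity)
    have h2 : 1 ≤ 1 + LG ^ 2 * (σ : ℝ) ^ 2 / (kG * (σ : ℝ) ^ α) :=
      le_add_of_nonneg_right (by positivity)
    rw [mul_assoc (4 * T * m / δ)]
    exact le_mul_of_one_le_right (by positivity) (one_le_mul_of_one_le_of_one_le h1 h2)
  set r := inputRadius T m dx δ σ LF LG kG α Δ with hr
  have hr0 : (σ : ℝ) * (3 + 16 * √(Lg / dx)) ≤ r := by
    rw [hr, inputRadius]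
    gcongr
  have hrpos : 0 < r := lt_of_lt_of_le (by positivity) hr0
  set KG := kG * r ^ α with hKGdef
  have hKG : 0 < KG := by positivity
  have hDr : D {z | r < ‖z‖} ≤ ENNReal.ofReal (δ / (4 * T * m)) := by
    rw [← hexp]
    exact hM.measure_input_gt_le hσ hr0 hLg0
  set rv := noiseRadius T m dy δ ν with hrv
  have hrv0 : 0 ≤ rv := by
    rw [hrv, noiseRadius]
    positivity
  set l := netLog T m dy δ ν LF Δ with hl
  set A := LF * Δ * T * m * (1 + rv) with hA
  have hA0 : 0 ≤ A := by positivity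
  have hlA : l = Real.log (1 + A) := rfl
  have hl0 : 0 ≤ l := by
    rw [hlA]
    exact Real.log_nonneg (by linarith)
  have hlog4 : 1 ≤ Real.log (4 / δ) := one_le_log_four_div hδ hδ1
  have hpl : 0 ≤ p * l := by positivity
  have hfin : momentRatio D g T f Θ θs ≠ ⊤ := by
    intro htop
    have h1 := hsize (lastTask T)
    rw [htop, ENNReal.top_pow two_ne_zero, ENNReal.top_mul
      (ENNReal.ofReal_pos.2 (by linarith)).ne', top_le_iff] at h1
    exact ENNReal.natCast_ne_top _ h1
  set κ := (momentRatio D g T f Θ θs).toReal with hκ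
  have hsize' : ∀ t, κ ^ 2 * (64 * (p * l + Real.log (4 / δ))) ≤ (R t).card := by
    intro t
    have h1 := ENNReal.toReal_mono (ENNReal.natCast_ne_top _) (hsize t)
    rwa [ENNReal.toReal_mul, ENNReal.toReal_pow, ENNReal.toReal_natCast,
      ENNReal.toReal_ofReal (by linarith)] at h1
  have hcm : ∀ t, ((R t).card : ℝ) ≤ m := fun t => by
    exact_mod_cast (Finset.card_le_univ (R t)).trans (by simp)
  -- The sample size condition itself gives `κ² ≤ n_t ≤ m`, which the tail bound `δ/(4Tm)`
  -- outweighs.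
  have hκr : κ ^ 2 * D.real {z | r < ‖z‖} ≤ 1 / 4 := by
    have h1 : D.real {z | r < ‖z‖} ≤ δ / (4 * T * m) :=
      ENNReal.toReal_le_of_le_ofReal (by positivity) hDr
    have h2 : κ ^ 2 ≤ m := by
      refine le_trans ?_ ((hsize' (lastTask T)).trans (hcm _))
      exact le_mul_of_one_le_right (by positivity) (by linarith)
    calc κ ^ 2 * D.real {z | r < ‖z‖} ≤ m * (δ / (4 * T * m)) := by gcongr
      _ = δ / (4 * T) := by field_simp
      _ ≤ 1 / 4 := by
        rw [div_le_div_iff₀ (by positivity) (by norm_num)]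
        linarith
  have hmono : ∀ {ω : Ω}, ∑ t : Fin T, distillWeight T t * ((R t).card *
      ∫ z, ‖directDiff g f θs (θhat (lastTask T) ω) t z‖ ^ 2 ∂D)
      ≤ 64 * ((ν : ℝ) ^ 2 * (p * T * l + Real.log (4 / δ)) + KG) →
      weightedError D g f θs R (θhat (lastTask T) ω)
        ≤ 64 * ((ν : ℝ) ^ 2 * (p * T * l + Real.log (4 / δ)) + KG) / totalWeight R := by
    intro ω h
    rw [weightedError_eq_div]
    exact div_le_div_of_nonneg_right h (totalWeight_nonneg R)
  have hν0 : 0 ≤ (ν : ℝ) ^ 2 * (p * T * l + Real.log (4 / δ)) := by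
    have : 0 ≤ p * T * l := by positivity
    have : 0 ≤ p * T * l + Real.log (4 / δ) := by linarith
    positivity
  -- If `LF Δ m ≤ 1`, all of `Θ` is so close to `θs` that the error is at most a multiple of `KG`
  -- without any concentration. Otherwise `ℓ` is large enough to pay for the union over tasks.
  rcases le_or_gt (LF * Δ * m) 1 with hsmall | hlarge
  · have hseq0 := ae_iff.1 hseq
    refine le_of_eq_of_le ?_ (zero_le (a := ENNReal.ofReal δ))
    refine measure_mono_null (fun ω hω => ?_) hseq0
    refine fun hgood => hω (hmono ?_)
    have hθ : θhat (lastTask T) ω ∈ Θ := (hgood (lastTask T)).1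
    have hd : ‖θhat (lastTask T) ω - θs‖ ≤ Δ := by
      rw [← dist_eq_norm]
      exact Metric.dist_le_diam_of_mem hΘ hθ hθs
    have h1 : ∀ t : Fin T, distillWeight T t * ((R t).card *
        ∫ z, ‖directDiff g f θs (θhat (lastTask T) ω) t z‖ ^ 2 ∂D)
        ≤ distillWeight T t * (2 * KG) := by
      intro t
      have h2 := integral_sq_le_of_dist_le hMom hLip hKG.le hLF.le hfin hκr hθ hθs hd t
      simp only [directDiff_eq_zero (rfl : f θs = f θs), norm_zero, ne_eq, OfNat.ofNat_ne_zero,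
        not_false_eq_true, zero_pow, integral_zero, zero_add] at h2
      refine mul_le_mul_of_nonneg_left ?_ (distillWeight_pos t).le
      calc _ ≤ (m : ℝ) * (2 * (KG * LF * Δ)) := by
            refine mul_le_mul (hcm t) h2 (integral_nonneg fun z => by positivity) (by positivity)
        _ = 2 * KG * (LF * Δ * m) := by ring
        _ ≤ 2 * KG * 1 := by gcongr
        _ = 2 * KG := by ring
    refine (Finset.sum_le_sum fun t _ => h1 t).trans ?_
    rw [← Finset.sum_mul]
    have h3 := mul_le_mul_of_nonneg_right (sum_distillWeight_le (T := T))
      (by positivity : 0 ≤ 2 * KG)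
    linarith
  -- This radius makes the discretization error `T m KG LF ε (1 + rv)` equal to `KG`, and the
  -- covering number at most `(1 + 2A) ^ p`.
  · set ε := 1 / (LF * T * m * (1 + rv)) with hε
    have hε0 : 0 < ε := by positivity
    obtain ⟨N, hN, hN0, hNcard, hnet⟩ := exists_finite_net hε0 hΘ hθs
    have hNc : (1 : ℝ) ≤ N.card := by exact_mod_cast hN0.card_pos
    have hp : (1 : ℝ) ≤ p := by
      rcases Nat.eq_zero_or_pos p with rfl | hp
      · exfalso
        have : Δ = 0 := Metric.diam_subsingleton (Set.subsingleton_of_subsingleton)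
        rw [this] at hlarge
        norm_num at hlarge
      · exact_mod_cast hp
    have hlogN : Real.log N.card ≤ 2 * (p * l) := by
      have h1 : 2 * Δ / ε = 2 * A := by
        rw [hε, hA]
        field_simp
      rw [← hΔ, h1] at hNcard
      exact log_le_of_le_pow hNc hA0 hNcard
    -- From `LF Δ m > 1` follows `A ≥ T`; this is where the case split enters.
    have hlogT : Real.log T ≤ p * l := by
      have h1 : (T : ℝ) ≤ 1 + A := by
        have h2 : A = LF * Δ * m * (T * (1 + rv)) := by rw [hA]; ring
        have h3 : (T : ℝ) ≤ T * (1 + rv) := le_mul_of_one_le_right (by positivity) (by linarith)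
        have h4 : T * (1 + rv) ≤ LF * Δ * m * (T * (1 + rv)) :=
          le_mul_of_one_le_left (by positivity) hlarge.le
        linarith
      have h5 := Real.log_le_log (by linarith) h1
      rw [← hlA] at h5
      exact h5.trans (le_mul_of_one_le_left hl0 hp)
    have hκ2 : 0 ≤ κ ^ 2 := sq_nonneg κ
    have hx4 : δ / (4 * T * m) ≤ δ / (4 * m) :=
      div_le_div_of_nonneg_left hδ.le (by positivity)
        (mul_le_mul_of_nonneg_right (le_mul_of_one_le_right (by norm_num) hT) (by positivity))
    have hv4 : ∀ t i, P {ω | rv < ‖v t i ω‖} ≤ ENNReal.ofReal (δ / (4 * T * m)) := fun t i => by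
      rw [← hexp]
      exact hM.measure_noise_gt_le t i hLg0
    have hcard : ∀ t, 8 * κ ^ 2 * (Real.log T + Real.log N.card + Real.log (4 / δ))
        ≤ (R t).card := fun t => by
      refine le_trans ?_ (hsize' t)
      rw [mul_comm (8 : ℝ), mul_assoc]
      refine mul_le_mul_of_nonneg_left ?_ hκ2
      linarith
    have hrν : ν = 0 → rv = 0 := fun h0 => by rw [hrv, noiseRadius, h0]; simp
    have hbound := exists_good_event hM hMom hLip hKG.le hLF.le hm hδ hrv0
      hrν hε0.le hθs hfin hκr hN hN0 hnet (hDr.trans (ENNReal.ofReal_le_ofReal hx4)) hv4 hcard hseq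
    refine (measure_mono fun ω hω => ?_).trans hbound
    refine fun hle => hω (hmono (hle.trans ?_))
    have h1 : T * m * (KG * LF * ε * (1 + rv)) = KG := by
      rw [hε]
      field_simp
    rw [h1]
    have h2 : T * Real.log N.card + Real.log (4 / δ) ≤ 2 * (p * T * l + Real.log (4 / δ)) := by
      have := mul_le_mul_of_nonneg_left hlogN (by positivity : (0 : ℝ) ≤ T)
      linarith
    have h3 := mul_le_mul_of_nonneg_left h2 (sq_nonneg (ν : ℝ))
    linarith
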